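/- Let $K>0$. Let $A\mapsto\overline{A}$ denote the closure of operators. In $L^2_{\mathbb C}(\mathbb R)$ let $\bar p_\xi$ be the (self-adjoint) closure of the operator $C_0^\infty(\mathbb R,\mathbb C)\ni\varphi\mapsto \frac{i}{K}\varphi'$, and for $\tau\in\mathbb R$ let $\cos(\tau\bar p_\xi)$ and $\frac{\sin(\tau\bar p_\xi)}{\bar p_\xi}$ be the bounded operators that the functional calculus for $\bar p_\xi$ associates with the functions $k\mapsto\cos(\tau k)$ and $k\mapsto\frac{\sin(\tau k)}{k}$ (the latter extended continuously to $k=0$ by the value $\tau$). Let $B^{1/2}$ and $B^{-1/2}$ be the maximal multiplication operators in $L^2_{\mathbb C}(\mathbb R)$ by $e^{-K\xi}$ and by $e^{K\xi}$, respectively, and let $V:L^2_{\mathbb C}(\mathbb R)\to L^2_{\mathbb C}(\mathbb R,e^{2K\xi})$ be the Hilbert space isomorphism $Vf=e^{-K\xi}f$. Compositions of operators are taken with their maximal domains. Then, for every $\tau\in\mathbb R$, the operators $B^{-1/2}\cos(\tau\bar p_\xi)B^{1/2}$ and $B^{-1/2}\frac{\sin(\tau\bar p_\xi)}{\bar p_\xi}B^{1/2}$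 are densely defined and closable, their closures are bounded operators defined on all of $L^2_{\mathbb C}(\mathbb R)$, and $$V\,\overline{B^{-1/2}\cos(\tau\bar p_\xi)B^{1/2}}\,V^{-1}f=\tfrac12\left[f\left(\cdot+\tfrac{\tau}{K}\right)+f\left(\cdot-\tfrac{\tau}{K}\right)\right],$$ $$V\,\overline{B^{-1/2}\tfrac{\sin(\tau\bar p_\xi)}{\bar p_\xi}B^{1/2}}\,V^{-1}g=\tfrac K2\,\operatorname{sgn}(\tau)\,\left(\chi_{[-|\tau|/K,\,|\tau|/K]}*g\right)$$ for all $f,g\in L^2_{\mathbb C}(\mathbb R,e^{2K\xi})$, where $\operatorname{sgn}=\chi_{(0,\infty)}-\chi_{(-\infty,0)}$, $\chi_I$ is the characteristic function of $I$, and $*$ is the convolution product. In particular, the operators on the left-hand sides are bounded operators on $L^2_{\mathbb C}(\mathbb R,e^{2K\xi})$. -/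

import Mathlib

open MeasureTheory Filter
open scoped ContDiff

noncomputable section

universe u v w

/-! ### Unbounded operators -/

section Operators

variable {E : Type u} {F : Type v} {G : Type w}
  [NormedAddCommGroup E] [InnerProductSpace ℂ E]
  [NormedAddCommGroup F] [InnerProductSpace ℂ F]
  [NormedAddCommGroup G] [InnerProductSpace ℂ G]

/-- The maximally defined composition `S ∘ T` of two partially defined linear operators, with
domain `{x ∈ D(T) | T x ∈ D(S)}`. -/
def LinearPMap.maxComp (S : F →ₗ.[ℂ] G) (T : E →ₗ.[ℂ] F) : E →ₗ.[ℂ] G where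
  domain :=
    { carrier := {x | ∃ h : x ∈ T.domain, T ⟨x, h⟩ ∈ S.domain}
      zero_mem' := ⟨T.domain.zero_mem, by
        have h0 : T ⟨0, T.domain.zero_mem⟩ = 0 := T.map_zero
        rw [h0]; exact S.domain.zero_mem⟩
      add_mem' := by
        rintro x y ⟨hx, hx'⟩ ⟨hy, hy'⟩
        refine ⟨T.domain.add_mem hx hy, ?_⟩
        have h := T.map_add ⟨x, hx⟩ ⟨y, hy⟩
        have h' : T ⟨x + y, T.domain.add_mem hx hy⟩ = T ⟨x, hx⟩ + T ⟨y, hy⟩ := h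
        rw [h']; exact S.domain.add_mem hx' hy'
      smul_mem' := by
        rintro c x ⟨hx, hx'⟩
        refine ⟨T.domain.smul_mem c hx, ?_⟩
        have h := T.map_smul c ⟨x, hx⟩
        have h' : T ⟨c • x, T.domain.smul_mem c hx⟩ = c • T ⟨x, hx⟩ := h
        rw [h']; exact S.domain.smul_mem c hx' }
  toFun :=
    { toFun := fun x => S ⟨T ⟨x.1, x.2.1⟩, x.2.2⟩
      map_add' := by
        rintro ⟨x, hx, hx'⟩ ⟨y, hy, hy'⟩
        rw [← S.map_add]
        congr 1
        exact Subtype.ext (T.map_add ⟨x, hx⟩ ⟨y, hy⟩)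
      map_smul' := by
        rintro c ⟨x, hx, hx'⟩
        rw [RingHom.id_apply, ← S.map_smul]
        congr 1
        exact Subtype.ext (T.map_smul c ⟨x, hx⟩) }

/-- The operator `U T U⁻¹` in `F`, with domain `U (D(T))`, for an operator `T` in `E` and a
Hilbert space isomorphism `U : E → F`. -/
def LinearPMap.transport (T : E →ₗ.[ℂ] E) (U : E ≃ₗᵢ[ℂ] F) : F →ₗ.[ℂ] F where
  domain := T.domain.comap U.symm.toLinearEquiv.toLinearMap
  toFun :=
    { toFun := fun y => U (T ⟨U.symm y.1, y.2⟩)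
      map_add' := by
        rintro ⟨x, hx⟩ ⟨y, hy⟩
        rw [← U.map_add, ← T.map_add]
        congr 2
        exact Subtype.ext (U.symm.map_add x y)
      map_smul' := by
        rintro c ⟨x, hx⟩
        rw [RingHom.id_apply, ← U.map_smul, ← T.map_smul]
        congr 2
        exact Subtype.ext (U.symm.map_smul c x) }

end Operators

/-! ### Multiplication operators and the functional calculus -/

/-- The maximal multiplication operator `T_g : f ↦ g · f` in `L²(μ)`, with domain
`{f ∈ L²(μ) | g · f ∈ L²(μ)}`. -/
def mulOp {Ω : Type u} [MeasurableSpace Ω] (μ : Measure Ω) (g : Ω → ℂ) :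
    Lp ℂ 2 μ →ₗ.[ℂ] Lp ℂ 2 μ where
  domain :=
    { carrier := {f | MemLp (fun x => g x * f x) 2 μ}
      zero_mem' := (MemLp.zero' : MemLp (fun _ : Ω => (0 : ℂ)) 2 μ).ae_eq (by
        filter_upwards [Lp.coeFn_zero ℂ 2 μ] with x h
        rw [h]; simp)
      add_mem' := by
        intro f₁ f₂ h₁ h₂
        refine (MemLp.add h₁ h₂).ae_eq ?_
        filter_upwards [Lp.coeFn_add f₁ f₂] with x h
        rw [h]; simp [mul_add]
      smul_mem' := by
        intro c f h
        refine (MemLp.const_smul h c).ae_eq ?_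
        filter_upwards [Lp.coeFn_smul c f] with x h
        rw [h]; simp [mul_left_comm] }
  toFun :=
    { toFun := fun f => MemLp.toLp (fun x => g x * f.1 x) f.2
      map_add' := by
        rintro ⟨f₁, h₁⟩ ⟨f₂, h₂⟩
        rw [← MemLp.toLp_add]
        refine MemLp.toLp_congr _ _ ?_
        filter_upwards [Lp.coeFn_add f₁ f₂] with x h
        rw [Pi.add_apply] at h ⊢
        exact (congrArg (g x * ·) h).trans (mul_add _ _ _)
      map_smul' := by
        rintro c ⟨f, hf⟩
        rw [RingHom.id_apply, ← MemLp.toLp_const_smul]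
        refine MemLp.toLp_congr _ _ ?_
        filter_upwards [Lp.coeFn_smul c f] with x h
        simp [h, mul_left_comm] }

/-- A spectral representation of an operator `T` in a Hilbert space `H`: a Hilbert space
isomorphism `U` from `H` onto some `L²(Ω, μ)` that turns `T` into the maximal multiplication
operator by a measurable real-valued function `a`. By the spectral theorem, such a representation
exists precisely when `T` is densely defined and self-adjoint. -/
structure SpectralRepresentation {H : Type u} [NormedAddCommGroup H] [InnerProductSpace ℂ H]
    (T : H →ₗ.[ℂ] H) where
  /-- the underlying set of the measure space -/
  Ω : Type u
  /-- its σ-algebra -/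
  mΩ : MeasurableSpace Ω
  /-- its measure -/
  μ : Measure Ω
  /-- the real-valued multiplier -/
  a : Ω → ℝ
  measurable_a : Measurable a
  /-- the diagonalizing Hilbert space isomorphism -/
  U : H ≃ₗᵢ[ℂ] Lp ℂ 2 μ
  diagonalizes : (mulOp μ (fun x => (a x : ℂ))).transport U.symm = T

/-- The operator `f(T) = U⁻¹ T_{f ∘ a} U` obtained from a spectral representation of `T`. -/
def SpectralRepresentation.apply {H : Type u} [NormedAddCommGroup H] [InnerProductSpace ℂ H]
    {T : H →ₗ.[ℂ] H} (R : SpectralRepresentation T) (f : ℝ → ℂ) : H →ₗ.[ℂ] H :=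
  letI := R.mΩ
  (mulOp R.μ (fun x => f (R.a x))).transport R.U.symm

open Classical in
/-- The functional calculus: `funcCalc T f` is the operator `f(T)`, for a self-adjoint operator `T`
and a Borel function `f : ℝ → ℂ`. It is computed in a spectral representation of `T`, and it is
well known that all of these give the same operator. (If `T` has no spectral representation, i.e.
is not self-adjoint, the value is the operator with domain `{0}`.) -/
def funcCalc {H : Type u} [NormedAddCommGroup H] [InnerProductSpace ℂ H]
    (T : H →ₗ.[ℂ] H) (f : ℝ → ℂ) : H →ₗ.[ℂ] H :=
  if h : Nonempty (SpectralRepresentation T) then h.some.apply f else ⊥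

/-! ### The operator `p̄` in `L²(ℝ)` -/

/-- The Hilbert space `L²(ℝ)` of complex-valued functions. -/
abbrev L2 : Type := Lp ℂ 2 (volume : Measure ℝ)

/-- The space `C₀^∞(ℝ, ℂ)` of smooth functions with compact support. -/
def testFunctions : Submodule ℂ (ℝ → ℂ) where
  carrier := {φ | ContDiff ℝ ∞ φ ∧ HasCompactSupport φ}
  zero_mem' := ⟨contDiff_const, HasCompactSupport.zero⟩
  add_mem' := fun h₁ h₂ => ⟨h₁.1.add h₂.1, h₁.2.add h₂.2⟩
  smul_mem' := fun c _ h =>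
    ⟨contDiff_const.smul h.1, HasCompactSupport.smul_left (f := fun _ => c) h.2⟩

theorem testFunctions_memLp {φ : ℝ → ℂ} (h : φ ∈ testFunctions) :
    MemLp φ 2 (volume : Measure ℝ) :=
  h.1.continuous.memLp_of_hasCompactSupport h.2

theorem testFunctions_deriv_memLp {φ : ℝ → ℂ} (h : φ ∈ testFunctions) :
    MemLp (deriv φ) 2 (volume : Measure ℝ) :=
  (h.1.continuous_deriv (by simp)).memLp_of_hasCompactSupport h.2.deriv

/-- The embedding `C₀^∞(ℝ, ℂ) → L²(ℝ)`. -/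
def testToL2 : testFunctions →ₗ[ℂ] L2 where
  toFun φ := (testFunctions_memLp φ.2).toLp φ.1
  map_add' _ _ := rfl
  map_smul' _ _ := rfl

theorem testToL2_injective : Function.Injective testToL2 := by
  intro φ ψ h
  have h' := (MemLp.toLp_eq_toLp_iff (testFunctions_memLp φ.2) (testFunctions_memLp ψ.2)).1 h
  exact Subtype.ext
    ((Continuous.ae_eq_iff_eq volume φ.2.1.continuous ψ.2.1.continuous).1 h')

/-- The map `C₀^∞(ℝ, ℂ) → L²(ℝ)`, `φ ↦ φ'`. -/
def testDerivToL2 : testFunctions →ₗ[ℂ] L2 where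
  toFun φ := (testFunctions_deriv_memLp φ.2).toLp (deriv φ.1)
  map_add' φ ψ := by
    rw [← MemLp.toLp_add]
    refine MemLp.toLp_congr _ _ (Eventually.of_forall fun x => ?_)
    exact deriv_add (φ.2.1.differentiable (by simp) x) (ψ.2.1.differentiable (by simp) x)
  map_smul' c φ := by
    rw [RingHom.id_apply, ← MemLp.toLp_const_smul]
    refine MemLp.toLp_congr _ _ (Eventually.of_forall fun x => ?_)
    exact deriv_const_smul c (φ.2.1.differentiable (by simp) x)

/-- The operator `p` in `L²(ℝ)` with domain `C₀^∞(ℝ, ℂ)`, given by `φ ↦ (i / K) φ'`. -/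
def pOp (K : ℝ) : L2 →ₗ.[ℂ] L2 where
  domain := LinearMap.range testToL2
  toFun := ((Complex.I / (K : ℂ)) • testDerivToL2) ∘ₗ
    (LinearEquiv.ofInjective testToL2 testToL2_injective).symm.toLinearMap

/-- The closure `p̄` of `p`. -/
def pBar (K : ℝ) : L2 →ₗ.[ℂ] L2 := (pOp K).closure

/-- The operator `cos(τ p̄)`. -/
def cosOp (K τ : ℝ) : L2 →ₗ.[ℂ] L2 :=
  funcCalc (pBar K) (fun k => (Real.cos (τ * k) : ℂ))

/-- The operator `sin(τ p̄) / p̄`: the functional calculus of `p̄` is applied to the continuous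
extension `k ↦ τ sinc(τ k)` of `k ↦ sin(τ k) / k` to all of `ℝ`. -/
def sinDivOp (K τ : ℝ) : L2 →ₗ.[ℂ] L2 :=
  funcCalc (pBar K) (fun k => ((τ * Real.sinc (τ * k) : ℝ) : ℂ))

/-- The operator `B^{1/2}` in `L²(ℝ)`, the maximal multiplication operator by `e^{-Kξ}`. -/
def BHalf (K : ℝ) : L2 →ₗ.[ℂ] L2 := mulOp volume (fun ξ => (Real.exp (-(K * ξ)) : ℂ))

/-- The operator `B^{-1/2}` in `L²(ℝ)`, the maximal multiplication operator by `e^{Kξ}`. -/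
def BNegHalf (K : ℝ) : L2 →ₗ.[ℂ] L2 := mulOp volume (fun ξ => (Real.exp (K * ξ) : ℂ))

/-- The operator `B^{-1/2} T B^{1/2}` in `L²(ℝ)`, with its maximal domain. -/
def BConj (K : ℝ) (T : L2 →ₗ.[ℂ] L2) : L2 →ₗ.[ℂ] L2 :=
  (BNegHalf K).maxComp (T.maxComp (BHalf K))

/-! ### The weighted space and the isomorphism `V` -/

/-- The measure `e^{2Kξ} dξ` on `ℝ`. -/
def weightedMeasure (K : ℝ) : Measure ℝ :=
  (volume : Measure ℝ).withDensity (fun ξ => ENNReal.ofReal (Real.exp (2 * K * ξ)))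

/-- The Hilbert space `L²(ℝ, e^{2Kξ})` of complex-valued functions. -/
abbrev WeightedL2 (K : ℝ) : Type := Lp ℂ 2 (weightedMeasure K)

theorem weightedMeasure_ac (K : ℝ) : weightedMeasure K ≪ volume :=
  withDensity_absolutelyContinuous _ _

theorem ac_weightedMeasure (K : ℝ) : (volume : Measure ℝ) ≪ weightedMeasure K := by
  refine withDensity_absolutelyContinuous' (by fun_prop) (Eventually.of_forall fun ξ => ?_)
  simp [Real.exp_pos]

theorem eLpNorm_weighted (K : ℝ) (h : ℝ → ℂ) :
    eLpNorm h 2 (weightedMeasure K) = eLpNorm (fun ξ => (Real.exp (K * ξ) : ℂ) * h ξ) 2 volume := by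
  rw [eLpNorm_eq_lintegral_rpow_enorm_toReal (by simp) (by simp),
    eLpNorm_eq_lintegral_rpow_enorm_toReal (by simp) (by simp)]
  congr 1
  rw [weightedMeasure, lintegral_withDensity_eq_lintegral_mul_non_measurable _ (by fun_prop)
    (Eventually.of_forall fun ξ => ENNReal.ofReal_lt_top)]
  refine lintegral_congr fun ξ => ?_
  have h1 : ‖(Real.exp (K * ξ) : ℂ)‖ₑ = ENNReal.ofReal (Real.exp (K * ξ)) := by
    rw [← ofReal_norm, Complex.norm_real, Real.norm_of_nonneg (Real.exp_pos _).le]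
  have h2 : Real.exp (2 * K * ξ) = Real.exp (K * ξ) ^ 2 := by
    rw [← Real.exp_nat_mul]; congr 1; push_cast; ring
  rw [Pi.mul_apply, enorm_mul, h1, h2, ENNReal.ofReal_pow (Real.exp_pos _).le]
  simp [mul_pow]

theorem memLp_weighted_iff (K : ℝ) (h : ℝ → ℂ) :
    MemLp h 2 (weightedMeasure K) ↔
      MemLp (fun ξ => (Real.exp (K * ξ) : ℂ) * h ξ) 2 volume := by
  have hc : Continuous fun ξ : ℝ => (Real.exp (K * ξ) : ℂ) := by fun_prop
  have hc' : Continuous fun ξ : ℝ => (Real.exp (-(K * ξ)) : ℂ) := by fun_prop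
  constructor
  · rintro ⟨hm, hn⟩
    exact ⟨hc.aestronglyMeasurable.mul (hm.mono_ac (ac_weightedMeasure K)),
      by rwa [← eLpNorm_weighted]⟩
  · rintro ⟨hm, hn⟩
    refine ⟨?_, by rwa [eLpNorm_weighted]⟩
    refine ((hc'.aestronglyMeasurable.mul hm).congr (Eventually.of_forall fun ξ => ?_)).mono_ac
      (weightedMeasure_ac K)
    have : (Real.exp (-(K * ξ)) : ℂ) * (Real.exp (K * ξ) : ℂ) = 1 := by
      rw [← Complex.ofReal_mul, ← Real.exp_add]; simp
    change (Real.exp (-(K * ξ)) : ℂ) * ((Real.exp (K * ξ) : ℂ) * h ξ) = h ξ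
    rw [← mul_assoc, this, one_mul]

theorem exp_mul_exp_neg_mul (x : ℝ) (z : ℂ) :
    (Real.exp x : ℂ) * ((Real.exp (-x) : ℂ) * z) = z := by
  rw [← mul_assoc, ← Complex.ofReal_mul, ← Real.exp_add]; simp

theorem exp_neg_mul_exp_mul (x : ℝ) (z : ℂ) :
    (Real.exp (-x) : ℂ) * ((Real.exp x : ℂ) * z) = z := by
  rw [← mul_assoc, ← Complex.ofReal_mul, ← Real.exp_add]; simp

theorem VIso_memLp (K : ℝ) (f : L2) :
    MemLp (fun ξ => (Real.exp (-(K * ξ)) : ℂ) * f ξ) 2 (weightedMeasure K) := by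
  rw [memLp_weighted_iff]
  simp only [exp_mul_exp_neg_mul]
  exact Lp.memLp f

theorem VIso_symm_memLp (K : ℝ) (f : WeightedL2 K) :
    MemLp (fun ξ => (Real.exp (K * ξ) : ℂ) * f ξ) 2 volume :=
  (memLp_weighted_iff K f).1 (Lp.memLp f)

/-- The Hilbert space isomorphism `V : L²(ℝ) → L²(ℝ, e^{2Kξ})`, `V f = e^{-Kξ} f`, with inverse
`V⁻¹ f = e^{Kξ} f`. -/
def VIso (K : ℝ) : L2 ≃ₗᵢ[ℂ] WeightedL2 K where
  toFun f := (VIso_memLp K f).toLp (fun ξ => (Real.exp (-(K * ξ)) : ℂ) * f ξ)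
  invFun f := (VIso_symm_memLp K f).toLp (fun ξ => (Real.exp (K * ξ) : ℂ) * f ξ)
  map_add' f g := by
    rw [← MemLp.toLp_add]
    refine MemLp.toLp_congr _ _ ?_
    filter_upwards [(weightedMeasure_ac K).ae_le (Lp.coeFn_add f g)] with ξ h
    rw [Pi.add_apply] at h ⊢
    rw [h, mul_add]
  map_smul' c f := by
    rw [RingHom.id_apply, ← MemLp.toLp_const_smul]
    refine MemLp.toLp_congr _ _ ?_
    filter_upwards [(weightedMeasure_ac K).ae_le (Lp.coeFn_smul c f)] with ξ h
    rw [Pi.smul_apply] at h ⊢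
    rw [h, smul_eq_mul, smul_eq_mul, mul_left_comm]
  left_inv f := by
    refine Lp.ext ?_
    refine (MemLp.coeFn_toLp _).trans ?_
    filter_upwards [(ac_weightedMeasure K).ae_le (MemLp.coeFn_toLp (VIso_memLp K f))] with ξ h
    rw [h, exp_mul_exp_neg_mul]
  right_inv f := by
    refine Lp.ext ?_
    refine (MemLp.coeFn_toLp _).trans ?_
    filter_upwards [(weightedMeasure_ac K).ae_le (MemLp.coeFn_toLp (VIso_symm_memLp K f))] with ξ h
    rw [h, exp_neg_mul_exp_mul]
  norm_map' f := by
    change ‖(VIso_memLp K f).toLp _‖ = ‖f‖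
    rw [Lp.norm_toLp, Lp.norm_def, eLpNorm_weighted]
    simp only [exp_mul_exp_neg_mul]

end

/-! The Fourier transform turns `pBar K` into multiplication by the real symbol $-2\pi k/K$. Hence
$e^{it\bar p}$ is translation by $-t/K$, so $\cos(\tau\bar p)$ averages the translations by
$\pm\tau/K$. The function $\tau\,\mathrm{sinc}(\tau\,\cdot)$ of the symbol is, up to the factor
$\frac K2\operatorname{sgn}\tau$, the transform of the indicator of $[-|\tau|/K,|\tau|/K]$, so
$\sin(\tau\bar p)/\bar p$ is a convolution (`cosOp_eq`, `sinDivOp_eq`).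

The weight $e^{-K\xi}$ is a character of the additive group. It therefore passes through a
translation at the cost of a constant, and through a convolution by replacing the kernel $1$ with
$e^{Kt}$, which is bounded on the compact interval. So each conjugated operator is a restriction of
an explicit bounded operator $D$ and agrees with $D$ on test functions; density makes $D$ its
closure (`BConj_closure_eq`). Conjugating by $V$ cancels the exponentials again.

Two points need real work. `funcCalc` uses an arbitrarily chosen spectral representation, so the
functions involved must be shown independent of it: `Rel.exp_congr` and `Rel.sinc_congr` obtain this
from uniqueness for differential equations in $t$. And the closure from test functions must be the
full Fourier multiplier (`pBar_eq_fourierMulOp`), i.e. test functions must form a core. -/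

noncomputable section

universe u v w

/-! ### Graphs of multiplication operators. -/

section MulOp

variable {Ω : Type u} [MeasurableSpace Ω] {μ : Measure Ω}

theorem mem_graph_mulOp_iff {g : Ω → ℂ} {x y : Lp ℂ 2 μ} :
    (x, y) ∈ (mulOp μ g).graph ↔ ⇑y =ᵐ[μ] fun w => g w * x w := by
  rw [LinearPMap.mem_graph_iff]
  constructor
  · rintro ⟨⟨z, hz⟩, rfl, h⟩
    rw [← show mulOp μ g ⟨z, hz⟩ = y from h]
    exact MemLp.coeFn_toLp (show MemLp (fun w => g w * z w) 2 μ from hz)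
  · intro h
    have hx : MemLp (fun w => g w * x w) 2 μ := (Lp.memLp y).ae_eq h
    refine ⟨⟨x, hx⟩, rfl, ?_⟩
    exact Lp.ext ((MemLp.coeFn_toLp hx).trans h.symm)

theorem Lp.exists_subseq_tendsto_ae {x : ℕ → Lp ℂ 2 μ} {a : Lp ℂ 2 μ}
    (h : Tendsto x atTop (nhds a)) :
    ∃ ns : ℕ → ℕ, StrictMono ns ∧
      ∀ᵐ w ∂μ, Tendsto (fun i => x (ns i) w) atTop (nhds (a w)) :=
  (tendstoInMeasure_of_tendsto_Lp h).exists_seq_tendsto_ae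

/-- $L^2$ convergence gives a.e. convergence along a subsequence, and the pointwise relation $y =
gx$ survives such limits. A second extraction makes both components converge a.e. -/
theorem mulOp_isClosed (g : Ω → ℂ) : (mulOp μ g).IsClosed := by
  refine IsSeqClosed.isClosed fun p q hp hpq => ?_
  obtain ⟨x, y⟩ := q
  have h1 : Tendsto (fun n => (p n).1) atTop (nhds x) := (continuous_fst.tendsto _).comp hpq
  have h2 : Tendsto (fun n => (p n).2) atTop (nhds y) := (continuous_snd.tendsto _).comp hpq
  obtain ⟨ns, hns, hx⟩ := Lp.exists_subseq_tendsto_ae h1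
  obtain ⟨ms, hms, hy⟩ := Lp.exists_subseq_tendsto_ae (h2.comp hns.tendsto_atTop)
  refine mem_graph_mulOp_iff.2 ?_
  have hall : ∀ᵐ w ∂μ, ∀ n, (p n).2 w = g w * (p n).1 w :=
    ae_all_iff.2 fun n => mem_graph_mulOp_iff.1 (hp n)
  filter_upwards [hx, hy, hall] with w hx hy hall
  refine tendsto_nhds_unique hy ?_
  have := (hx.comp hms.tendsto_atTop).const_mul (g w)
  refine this.congr fun n => ?_
  simp [hall]

theorem memLp_bdd_mul {g : Ω → ℂ} (hg : Measurable g) {C : ℝ} (hC : ∀ w, ‖g w‖ ≤ C)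
    (x : Lp ℂ 2 μ) : MemLp (fun w => g w * x w) 2 μ :=
  (Lp.memLp x).of_le_mul (c := C) (hg.aestronglyMeasurable.mul (Lp.aestronglyMeasurable x))
    (Eventually.of_forall fun w => by
      rw [norm_mul]; exact mul_le_mul_of_nonneg_right (hC w) (norm_nonneg _))

end MulOp

/-! ### Graphs of transported and everywhere defined operators. -/

section Transport

variable {E : Type u} {F : Type v}
  [NormedAddCommGroup E] [InnerProductSpace ℂ E]
  [NormedAddCommGroup F] [InnerProductSpace ℂ F]

theorem LinearPMap.mem_graph_transport_iff {T : E →ₗ.[ℂ] E} {U : E ≃ₗᵢ[ℂ] F} {x y : F} :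
    (x, y) ∈ (T.transport U).graph ↔ (U.symm x, U.symm y) ∈ T.graph := by
  simp only [LinearPMap.mem_graph_iff]
  constructor
  · rintro ⟨⟨z, hz⟩, rfl, h⟩
    refine ⟨⟨U.symm z, hz⟩, rfl, ?_⟩
    rw [← show U (T ⟨U.symm z, hz⟩) = y from h]
    exact (U.symm_apply_apply _).symm
  · rintro ⟨⟨z, hz⟩, h, h'⟩
    have h : z = U.symm x := h
    subst h
    refine ⟨⟨x, hz⟩, rfl, ?_⟩
    change U (T ⟨U.symm x, hz⟩) = y
    rw [h', U.apply_symm_apply]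

theorem LinearPMap.transport_isClosed {T : E →ₗ.[ℂ] E} (hT : T.IsClosed) (U : E ≃ₗᵢ[ℂ] F) :
    (T.transport U).IsClosed := by
  have h : ((T.transport U).graph : Set (F × F)) =
      (fun p : F × F => (U.symm p.1, U.symm p.2)) ⁻¹' (T.graph : Set (E × E)) := by
    ext ⟨x, y⟩
    exact LinearPMap.mem_graph_transport_iff
  rw [LinearPMap.IsClosed, h]
  exact IsClosed.preimage (by fun_prop) hT

theorem LinearPMap.mem_graph_toPMap_top_iff {A : E →ₗ[ℂ] F} {x : E} {y : F} :
    (x, y) ∈ (A.toPMap ⊤).graph ↔ A x = y := by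
  rw [LinearPMap.mem_graph_iff]
  constructor
  · rintro ⟨⟨z, hz⟩, rfl, h⟩
    exact h
  · rintro rfl
    exact ⟨⟨x, trivial⟩, rfl, rfl⟩

theorem LinearPMap.toPMap_top_isClosed (A : E →L[ℂ] F) :
    ((A : E →ₗ[ℂ] F).toPMap ⊤).IsClosed := by
  have h : ((((A : E →ₗ[ℂ] F).toPMap ⊤).graph : Submodule ℂ (E × F)) : Set (E × F)) =
      {p | A p.1 = p.2} := by
    ext ⟨x, y⟩
    exact LinearPMap.mem_graph_toPMap_top_iff
  rw [LinearPMap.IsClosed, h]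
  exact isClosed_eq (by fun_prop) (by fun_prop)

end Transport

/-! ### Independence of the functional calculus from the spectral representation. -/

namespace SpectralRepresentation

variable {H : Type u} [NormedAddCommGroup H] [InnerProductSpace ℂ H]
  {T : H →ₗ.[ℂ] H}

/-- The relation `y = f(T) x`, evaluated in a spectral representation of `T`. -/
def Rel (R : SpectralRepresentation T) (f : ℝ → ℂ) (x y : H) : Prop :=
  letI := R.mΩ
  ⇑(R.U y) =ᵐ[R.μ] fun w => f (R.a w) * R.U x w

variable (R : SpectralRepresentation T)

theorem mem_graph_apply_iff {f : ℝ → ℂ} {x y : H} :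
    (x, y) ∈ (R.apply f).graph ↔ R.Rel f x y := by
  let _ := R.mΩ
  unfold SpectralRepresentation.apply
  rw [LinearPMap.mem_graph_transport_iff, mem_graph_mulOp_iff]
  rfl

theorem mem_graph_iff {x y : H} : (x, y) ∈ T.graph ↔ R.Rel (fun k => (k : ℂ)) x y := by
  have h : R.apply (fun k => (k : ℂ)) = T := R.diagonalizes
  rw [← mem_graph_apply_iff, h]

theorem apply_isClosed (f : ℝ → ℂ) : (R.apply f).IsClosed := by
  let _ := R.mΩ
  exact LinearPMap.transport_isClosed (mulOp_isClosed _) _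

variable {R}

theorem Rel.unique {f : ℝ → ℂ} {x y y' : H} (h : R.Rel f x y) (h' : R.Rel f x y') : y = y' := by
  let _ := R.mΩ
  exact R.U.injective (Lp.ext (h.trans h'.symm))

theorem Rel.comp {f g : ℝ → ℂ} {x y z : H} (h : R.Rel f x y) (h' : R.Rel g y z) :
    R.Rel (fun k => g k * f k) x z := by
  let _ := R.mΩ
  unfold Rel at *
  filter_upwards [h, h'] with w h h'
  rw [h', h, mul_assoc]

theorem Rel.add_fun {f g : ℝ → ℂ} {x y z : H} (h : R.Rel f x y) (h' : R.Rel g x z) :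
    R.Rel (fun k => f k + g k) x (y + z) := by
  let _ := R.mΩ
  unfold Rel at *
  rw [map_add]
  filter_upwards [h, h', Lp.coeFn_add (R.U y) (R.U z)] with w h h' h''
  rw [h'', Pi.add_apply, h', h, add_mul]

theorem Rel.smul_fun {f : ℝ → ℂ} {x y : H} (h : R.Rel f x y) (c : ℂ) :
    R.Rel (fun k => c * f k) x (c • y) := by
  let _ := R.mΩ
  unfold Rel at *
  rw [map_smul]
  filter_upwards [h, Lp.coeFn_smul c (R.U y)] with w h h''
  rw [h'', Pi.smul_apply, h, smul_eq_mul, mul_assoc]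

theorem Rel.sub_fun {f g : ℝ → ℂ} {x y z : H} (h : R.Rel f x y) (h' : R.Rel g x z) :
    R.Rel (fun k => f k - g k) x (y - z) := by
  have := h.add_fun (h'.smul_fun (-1))
  simpa [sub_eq_add_neg] using this

theorem rel_one (x : H) : R.Rel (fun _ => 1) x x := by
  let _ := R.mΩ
  exact Eventually.of_forall fun w => (one_mul _).symm

theorem rel_zero (x : H) : R.Rel (fun _ => 0) x 0 := by
  have := (rel_one (R := R) x).smul_fun 0
  simpa using this

/-- Neither multiplier need be bounded, so estimates can be made against vectors such as $(1+T^2)x$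
or $(T+i)x$. -/
theorem Rel.norm_le {f g : ℝ → ℂ} {x y z : H} (h : R.Rel f x y) (h' : R.Rel g x z)
    (hfg : ∀ k, ‖f k‖ ≤ ‖g k‖) : ‖y‖ ≤ ‖z‖ := by
  let _ := R.mΩ
  rw [← R.U.norm_map y, ← R.U.norm_map z]
  refine Lp.norm_le_norm_of_ae_le ?_
  unfold Rel at *
  filter_upwards [h, h'] with w h h'
  rw [h, h', norm_mul, norm_mul]
  exact mul_le_mul_of_nonneg_right (hfg _) (norm_nonneg _)

variable (R)

theorem exists_rel {f : ℝ → ℂ} (hf : Measurable f) {C : ℝ} (hC : ∀ k, ‖f k‖ ≤ C) (x : H) :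
    ∃ y, R.Rel f x y := by
  let _ := R.mΩ
  have h := memLp_bdd_mul (μ := R.μ) (hf.comp R.measurable_a) (fun w => hC (R.a w)) (R.U x)
  refine ⟨R.U.symm (h.toLp _), ?_⟩
  unfold Rel
  rw [R.U.apply_symm_apply]
  exact MemLp.coeFn_toLp h

theorem im_inner_eq_zero {x y : H} (h : R.Rel (fun k => (k : ℂ)) x y) :
    (inner ℂ x y).im = 0 := by
  let _ := R.mΩ
  rw [← R.U.inner_map_map, MeasureTheory.L2.inner_def]
  have h1 : ∀ᵐ w ∂(R.μ), inner ℂ (R.U x w) (R.U y w) = ((R.a w * ‖R.U x w‖ ^ 2 : ℝ) : ℂ) := by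
    unfold Rel at h
    filter_upwards [h] with w h
    rw [h]
    simp only [RCLike.inner_apply, Complex.ofReal_mul, Complex.ofReal_pow]
    rw [mul_assoc, Complex.mul_conj']
  rw [integral_congr_ae h1]
  exact (congrArg Complex.im (integral_ofReal (𝕜 := ℂ))).trans (Complex.ofReal_im _)

/-- Differentiation of the functional calculus with respect to a parameter. -/
theorem hasDerivAt_rel {G g : ℝ → ℝ → ℂ} (hG : ∀ k t, HasDerivAt (fun s => G s k) (g t k) t)
    (hg : ∀ k s t, ‖g s k - g t k‖ ≤ (1 + k ^ 2) * |s - t|) {x z : H} {u v : ℝ → H}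
    (hz : R.Rel (fun k => ((1 + k ^ 2 : ℝ) : ℂ)) x z)
    (hu : ∀ t, R.Rel (G t) x (u t)) (hv : ∀ t, R.Rel (g t) x (v t)) (t : ℝ) :
    HasDerivAt u (v t) t := by
  -- First-order Taylor remainder, by the mean value inequality for $r\mapsto G(r,k)-(r-t)\,g(t,k)$
  -- between $t$ and $s$.
  have scalar : ∀ k s, ‖G s k - G t k - (s - t : ℝ) * g t k‖ ≤ (1 + k ^ 2) * |s - t| * |s - t| := by
    intro k s
    have hd : ∀ r ∈ Set.uIcc t s, HasDerivWithinAt (fun r => G r k - (r - t : ℝ) * g t k)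
        (g r k - g t k) (Set.uIcc t s) r := by
      intro r _
      have h1 : HasDerivAt (fun r : ℝ => ((r - t : ℝ) : ℂ)) 1 r := by
        simpa using ((hasDerivAt_id r).sub_const t).ofReal_comp
      simpa using ((hG k r).fun_sub (h1.mul_const (g t k))).hasDerivWithinAt
    have hb : ∀ r ∈ Set.uIcc t s, ‖g r k - g t k‖ ≤ (1 + k ^ 2) * |s - t| := by
      intro r hr
      refine (hg k r t).trans (mul_le_mul_of_nonneg_left ?_ (by positivity))
      rcases Set.mem_uIcc.1 hr with ⟨h1, h2⟩ | ⟨h1, h2⟩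
      · rw [abs_of_nonneg (by linarith), abs_of_nonneg (by linarith)]; linarith
      · rw [abs_of_nonpos (by linarith), abs_of_nonpos (by linarith)]; linarith
    have := (convex_uIcc t s).norm_image_sub_le_of_norm_hasDerivWithin_le hd hb
      Set.left_mem_uIcc Set.right_mem_uIcc
    rw [Real.norm_eq_abs] at this
    refine le_of_eq_of_le ?_ this
    congr 1
    simp
    ring
  -- The scalar bound grows like $1+k^2$; it transfers to vectors because $z=(1+T^2)x$ exists.
  have vec : ∀ s, ‖u s - u t - (s - t) • v t‖ ≤ ‖z‖ * |s - t| * |s - t| := by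
    intro s
    have h1 := ((hu s).sub_fun (hu t)).sub_fun ((hv t).smul_fun ((s - t : ℝ) : ℂ))
    have h2 := hz.smul_fun ((|s - t| * |s - t| : ℝ) : ℂ)
    have h3 := h1.norm_le h2 fun k => by
      refine (scalar k s).trans (le_of_eq ?_)
      rw [← Complex.ofReal_mul, Complex.norm_real, Real.norm_of_nonneg (by positivity)]
      ring
    rw [norm_smul, Complex.norm_real, Real.norm_of_nonneg (by positivity), Complex.coe_smul] at h3
    linarith
  rw [hasDerivAt_iff_isLittleO]
  refine Asymptotics.IsBigO.trans_isLittleO (g := fun s => (s - t) * (s - t)) ?_ ?_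
  · refine Asymptotics.IsBigO.of_bound ‖z‖ (Eventually.of_forall fun s => ?_)
    rw [norm_mul, Real.norm_eq_abs, ← mul_assoc]
    exact vec s
  · have h0 : Tendsto (fun s => s - t) (nhds t) (nhds 0) := by
      have : ContinuousAt (fun s => s - t) t := by fun_prop
      simpa [ContinuousAt] using this
    simpa using (Asymptotics.isLittleO_one_iff ℝ |>.2 h0).mul_isBigO
      (Asymptotics.isBigO_refl (fun s => s - t) (nhds t))

variable {R}

/-- A converse to `Rel.comp`: it places $f(T)x$ in the domain of $g(T)$ once $(gf)(T)x$ is known. -/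
theorem Rel.of_mul {f g h : ℝ → ℂ} (hgh : ∀ k, h k = g k * f k) {x y z : H} (hy : R.Rel f x y)
    (hz : R.Rel h x z) : R.Rel g y z := by
  let _ := R.mΩ
  unfold Rel at *
  filter_upwards [hy, hz] with w hy hz
  rw [hz, hy, hgh, mul_assoc]

theorem Rel.congr_fun {f g : ℝ → ℂ} (hfg : ∀ k, f k = g k) {x y : H} (h : R.Rel f x y) :
    R.Rel g x y := by
  rwa [← funext hfg]

theorem norm_exp_I_mul (t k : ℝ) : ‖Complex.exp (Complex.I * (t * k : ℝ))‖ = 1 := by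
  rw [mul_comm]; exact Complex.norm_exp_ofReal_mul_I _

variable (R)

theorem exists_rel_exp (t : ℝ) (x : H) :
    ∃ y, R.Rel (fun k => Complex.exp (Complex.I * (t * k : ℝ))) x y :=
  R.exists_rel (by fun_prop) (fun k => (norm_exp_I_mul t k).le) x

theorem hasDerivAt_exp (k t : ℝ) :
    HasDerivAt (fun s : ℝ => Complex.exp (Complex.I * (s * k : ℝ)))
      (Complex.I * k * Complex.exp (Complex.I * (t * k : ℝ))) t := by
  have h1 : HasDerivAt (fun s : ℝ => Complex.I * (s * k : ℝ)) (Complex.I * k) t := by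
    simpa using ((hasDerivAt_id t).mul_const k).ofReal_comp.const_mul Complex.I
  rw [mul_comm]
  exact h1.cexp

theorem norm_exp_sub_exp_le (k s t : ℝ) :
    ‖Complex.exp (Complex.I * (s * k : ℝ)) - Complex.exp (Complex.I * (t * k : ℝ))‖
      ≤ |k| * |s - t| := by
  have hb : ∀ r ∈ (Set.univ : Set ℝ),
      ‖Complex.I * k * Complex.exp (Complex.I * (r * k : ℝ))‖ ≤ |k| := by
    intro r _
    rw [norm_mul, norm_exp_I_mul]
    simp
  exact convex_univ.norm_image_sub_le_of_norm_hasDerivWithin_le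
    (fun r _ => (hasDerivAt_exp k r).hasDerivWithinAt) hb trivial trivial

variable {R}

theorem rel_one_add_sq {x y z : H} (hy : R.Rel (fun k => (k : ℂ)) x y)
    (hz : R.Rel (fun k => (k : ℂ)) y z) :
    R.Rel (fun k => ((1 + k ^ 2 : ℝ) : ℂ)) x (x + z) :=
  ((rel_one x).add_fun (hy.comp hz)).congr_fun fun k => by push_cast; ring

/-- The unitary group generated by `T` does not depend on the spectral representation. -/
theorem Rel.exp_congr {R' : SpectralRepresentation T} {x y z : H}
    (hy : (x, y) ∈ T.graph) (hz : (y, z) ∈ T.graph) {t : ℝ} {p : H}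
    (hp : R.Rel (fun k => Complex.exp (Complex.I * (t * k : ℝ))) x p) :
    R'.Rel (fun k => Complex.exp (Complex.I * (t * k : ℝ))) x p := by
  -- In each representation $u(t)=e^{itT}x$ solves $u'=iTu$. The equation is expressed through
  -- `T.graph`, which mentions no representation, so the two solutions can be compared.
  have key : ∀ S : SpectralRepresentation T, ∃ u v : ℝ → H,
      (∀ t, S.Rel (fun k => Complex.exp (Complex.I * (t * k : ℝ))) x (u t)) ∧
      (∀ t, (u t, v t) ∈ T.graph) ∧ ∀ t, HasDerivAt u (Complex.I • v t) t := by
    intro S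
    rw [S.mem_graph_iff] at hy hz
    choose u hu using fun t => S.exists_rel_exp t x
    choose v hv using fun t => S.exists_rel_exp t y
    refine ⟨u, v, hu, fun t => ?_, fun t => ?_⟩
    · rw [S.mem_graph_iff]
      exact (hu t).of_mul (fun k => mul_comm _ _) (hy.comp (hv t))
    · refine S.hasDerivAt_rel hasDerivAt_exp (fun k s t => ?_) (rel_one_add_sq hy hz) hu
        (fun t => ((hy.comp (hv t)).smul_fun Complex.I).congr_fun fun k => ?_) t
      · rw [← mul_sub, norm_mul]
        refine (mul_le_mul_of_nonneg_left (norm_exp_sub_exp_le k s t) (norm_nonneg _)).trans ?_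
        rw [← mul_assoc]
        refine mul_le_mul_of_nonneg_right ?_ (abs_nonneg _)
        simp only [norm_mul, Complex.norm_I, Complex.norm_real, Real.norm_eq_abs, one_mul,
          abs_mul_abs_self]
        linarith [sq k]
      · ring
  obtain ⟨u, v, hu, huv, hd⟩ := key R
  obtain ⟨u', v', hu', huv', hd'⟩ := key R'
  -- Uniqueness: for $w=u-u'$ the derivative of $\|w\|^2$ is $2\operatorname{Re}\langle
  -- w,iTw\rangle=-2\operatorname{Im}\langle w,Tw\rangle$, which vanishes by symmetry of $T$.
  have hw : ∀ t, HasDerivAt (fun t => inner ℂ (u t - u' t) (u t - u' t)) 0 t := by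
    intro t
    have h1 := (hd t).fun_sub (hd' t)
    rw [← smul_sub] at h1
    have h2 := h1.inner ℂ h1
    have h3 : (inner ℂ (u t - u' t) (v t - v' t)).im = 0 :=
      R.im_inner_eq_zero (R.mem_graph_iff.1 (T.graph.sub_mem (huv t) (huv' t)))
    refine h2.congr_deriv ?_
    rw [inner_smul_left, inner_smul_right, ← inner_conj_symm (v t - v' t),
      Complex.conj_eq_iff_im.2 h3, Complex.conj_I]
    ring
  have hconst := is_const_of_deriv_eq_zero (fun t => (hw t).differentiableAt)
    (fun t => (hw t).deriv)
  have h0 : u 0 = u' 0 := by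
    have e1 := (hu 0).unique ((rel_one x).congr_fun fun k => by simp)
    have e2 := (hu' 0).unique ((rel_one x).congr_fun fun k => by simp)
    rw [e1, e2]
  have ht := hconst t 0
  rw [h0, sub_self, inner_zero_left, inner_self_eq_zero, sub_eq_zero] at ht
  rw [hp.unique (hu t), ht]
  exact hu' t

theorem cos_eq_exp (t k : ℝ) : (Real.cos (t * k) : ℂ) = 1 / 2 *
    (Complex.exp (Complex.I * (t * k : ℝ)) + Complex.exp (Complex.I * (-t * k : ℝ))) := by
  rw [Complex.ofReal_cos, Complex.cos]
  push_cast
  ring_nf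

/-- `cos(t T)` does not depend on the spectral representation. -/
theorem Rel.cos_congr {R' : SpectralRepresentation T} {x y z : H}
    (hy : (x, y) ∈ T.graph) (hz : (y, z) ∈ T.graph) {t : ℝ} {p : H}
    (hp : R.Rel (fun k => (Real.cos (t * k) : ℂ)) x p) :
    R'.Rel (fun k => (Real.cos (t * k) : ℂ)) x p := by
  obtain ⟨q, hq⟩ := R.exists_rel_exp t x
  obtain ⟨q', hq'⟩ := R.exists_rel_exp (-t) x
  have h := fun (S : SpectralRepresentation T) (h1 : S.Rel _ x q) (h2 : S.Rel _ x q') =>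
    ((h1.add_fun h2).smul_fun (1 / 2)).congr_fun fun k => (cos_eq_exp t k).symm
  rw [hp.unique (h R hq hq')]
  exact h R' (hq.exp_congr hy hz) (hq'.exp_congr hy hz)

theorem hasDerivAt_mul_sinc (k t : ℝ) :
    HasDerivAt (fun s : ℝ => ((s * Real.sinc (s * k) : ℝ) : ℂ)) (Real.cos (t * k) : ℂ) t := by
  refine HasDerivAt.ofReal_comp ?_
  rcases eq_or_ne k 0 with rfl | hk
  · simpa using hasDerivAt_id' t
  · have h1 : (fun s : ℝ => s * Real.sinc (s * k)) = fun s => Real.sin (s * k) / k := by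
      funext s
      rcases eq_or_ne s 0 with rfl | hs
      · simp
      · rw [Real.sinc_of_ne_zero (mul_ne_zero hs hk)]
        field_simp
    rw [h1]
    have := (((hasDerivAt_id t).mul_const k).sin).div_const k
    simpa [hk] using this

/-- `sin(t T) / T` does not depend on the spectral representation. -/
theorem Rel.sinc_congr {R' : SpectralRepresentation T} {x y z : H}
    (hy : (x, y) ∈ T.graph) (hz : (y, z) ∈ T.graph) {t : ℝ} {p : H}
    (hp : R.Rel (fun k => ((t * Real.sinc (t * k) : ℝ) : ℂ)) x p) :
    R'.Rel (fun k => ((t * Real.sinc (t * k) : ℝ) : ℂ)) x p := by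
  have hcos : ∀ t, ∃ c, ∀ S : SpectralRepresentation T,
      S.Rel (fun k => (Real.cos (t * k) : ℂ)) x c := by
    intro t
    obtain ⟨c, hc⟩ := R.exists_rel (f := fun k => (Real.cos (t * k) : ℂ)) (by fun_prop) (C := 1)
      (fun k => by rw [Complex.norm_real]; exact Real.abs_cos_le_one _) x
    exact ⟨c, fun S => hc.cos_congr hy hz⟩
  choose c hc using hcos
  -- $t\mapsto \frac{\sin tT}{T}x$ starts at $0$ and has derivative $\cos(tT)x$, which is already
  -- known not to depend on the representation.
  have key : ∀ S : SpectralRepresentation T, ∃ u : ℝ → H,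
      (∀ t, S.Rel (fun k => ((t * Real.sinc (t * k) : ℝ) : ℂ)) x (u t)) ∧
      ∀ t, HasDerivAt u (c t) t := by
    intro S
    rw [S.mem_graph_iff] at hy hz
    choose u hu using fun t => S.exists_rel (f := fun k => ((t * Real.sinc (t * k) : ℝ) : ℂ))
      (by have := Real.continuous_sinc; fun_prop) (C := |t|)
      (fun k => by
        rw [Complex.norm_real, norm_mul]
        exact mul_le_of_le_one_right (abs_nonneg _) (Real.abs_sinc_le_one _)) x
    refine ⟨u, hu, S.hasDerivAt_rel hasDerivAt_mul_sinc (fun k s t => ?_)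
      (rel_one_add_sq hy hz) hu (fun t => hc t S)⟩
    rw [cos_eq_exp, cos_eq_exp, ← mul_sub, norm_mul, add_sub_add_comm]
    have h1 := norm_exp_sub_exp_le k s t
    have h2 := norm_exp_sub_exp_le k (-s) (-t)
    rw [show -s - -t = -(s - t) by ring, abs_neg] at h2
    have h3 := norm_add_le (Complex.exp (Complex.I * (s * k : ℝ)) -
      Complex.exp (Complex.I * (t * k : ℝ))) (Complex.exp (Complex.I * (-s * k : ℝ)) -
      Complex.exp (Complex.I * (-t * k : ℝ)))
    have h4 : |k| ≤ 1 + k ^ 2 := by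
      rw [← sq_abs]; nlinarith [sq_nonneg (|k| - 1), abs_nonneg k]
    have h5 := mul_le_mul_of_nonneg_right h4 (abs_nonneg (s - t))
    have h6 : ‖(1 / 2 : ℂ)‖ = 1 / 2 := by norm_num
    rw [h6]
    linarith
  obtain ⟨u, hu, hd⟩ := key R
  obtain ⟨u', hu', hd'⟩ := key R'
  have hw : ∀ t, HasDerivAt (fun t => u t - u' t) 0 t := fun t => by
    simpa using (hd t).fun_sub (hd' t)
  have ht := is_const_of_deriv_eq_zero (fun t => (hw t).differentiableAt)
    (fun t => (hw t).deriv) t 0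
  have e1 := (hu 0).unique ((rel_zero x).congr_fun fun k => by simp)
  have e2 := (hu' 0).unique ((rel_zero x).congr_fun fun k => by simp)
  rw [e1, e2, sub_self, sub_eq_zero] at ht
  rw [hp.unique (hu t), ht]
  exact hu' t

variable (R)

/-- If `f(T)` agrees with a bounded operator on a dense set, then they are equal. -/
theorem apply_eq_toPMap {f : ℝ → ℂ} (A : H →L[ℂ] H) {s : Set H} (hs : Dense s)
    (h : ∀ x ∈ s, R.Rel f x (A x)) : R.apply f = (A : H →ₗ[ℂ] H).toPMap ⊤ := by
  have hall : ∀ x, R.Rel f x (A x) := by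
    have hc : IsClosed {x | (x, A x) ∈ ((R.apply f).graph : Set (H × H))} :=
      (R.apply_isClosed f).preimage (by fun_prop)
    intro x
    rw [← mem_graph_apply_iff]
    refine hc.closure_subset_iff.2 (fun x hx => ?_) (hs x)
    exact R.mem_graph_apply_iff.2 (h x hx)
  refine LinearPMap.eq_of_eq_graph (SetLike.ext fun p => ?_)
  obtain ⟨x, y⟩ := p
  rw [mem_graph_apply_iff, LinearPMap.mem_graph_toPMap_top_iff]
  constructor
  · intro hy
    exact (hall x).unique hy
  · rintro rfl
    exact hall x

end SpectralRepresentation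

/-- The representation inside `funcCalc` comes from choice, so the value of $f(T)$ has to be
verified in all of them. -/
theorem funcCalc_eq_toPMap {H : Type u} [NormedAddCommGroup H] [InnerProductSpace ℂ H]
    {T : H →ₗ.[ℂ] H} (hT : Nonempty (SpectralRepresentation T)) {f : ℝ → ℂ} {A : H →L[ℂ] H}
    (h : ∀ R : SpectralRepresentation T, R.apply f = (A : H →ₗ[ℂ] H).toPMap ⊤) :
    funcCalc T f = (A : H →ₗ[ℂ] H).toPMap ⊤ := by
  rw [funcCalc, dif_pos hT]
  exact h _

/-! ### The spectral representation of `p̄` by the Fourier transform -/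

open scoped FourierTransform SchwartzMap

/-- A test function as a Schwartz function. -/
def testToSchwartz (φ : testFunctions) : 𝓢(ℝ, ℂ) := φ.2.2.toSchwartzMap φ.2.1

theorem testToL2_eq_toLp (φ : testFunctions) : testToL2 φ = (testToSchwartz φ).toLp 2 := rfl

theorem coeFn_testToL2 (φ : testFunctions) : ⇑(testToL2 φ) =ᵐ[volume] φ.1 :=
  MemLp.coeFn_toLp (testFunctions_memLp φ.2)

theorem dense_range_testToL2 : Dense (Set.range testToL2) := by
  intro f
  refine (mem_closure_iff_nhds_basis Metric.nhds_basis_closedBall).2 fun ε hε => ?_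
  obtain ⟨g, hg₁, hg₂, hg₃⟩ := MemLp.exist_eLpNorm_sub_le (by simp) (by simp) (Lp.memLp f) hε
  refine ⟨_, ⟨⟨g, hg₂, hg₁⟩, rfl⟩, ?_⟩
  rw [Metric.mem_closedBall', Lp.dist_def]
  refine ENNReal.toReal_le_of_le_ofReal hε.le ((eLpNorm_congr_ae ?_).trans_le hg₃)
  filter_upwards [coeFn_testToL2 ⟨g, hg₂, hg₁⟩] with x hx
  simp [hx]

theorem mem_graph_pOp_iff {K : ℝ} {x y : L2} : (x, y) ∈ (pOp K).graph ↔
    ∃ φ, testToL2 φ = x ∧ (Complex.I / (K : ℂ)) • testDerivToL2 φ = y := by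
  have hval : ∀ φ, pOp K ⟨testToL2 φ, φ, rfl⟩ = (Complex.I / (K : ℂ)) • testDerivToL2 φ := by
    intro φ
    have h : (LinearEquiv.ofInjective testToL2 testToL2_injective).symm ⟨testToL2 φ, φ, rfl⟩ = φ :=
      (LinearEquiv.ofInjective testToL2 testToL2_injective).symm_apply_apply φ
    change (Complex.I / (K : ℂ)) • testDerivToL2
      ((LinearEquiv.ofInjective testToL2 testToL2_injective).symm ⟨testToL2 φ, φ, rfl⟩) = _
    rw [h]
  rw [LinearPMap.mem_graph_iff]
  constructor
  · rintro ⟨⟨_, φ, rfl⟩, rfl, h⟩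
    exact ⟨φ, rfl, (hval φ).symm.trans h⟩
  · rintro ⟨φ, rfl, rfl⟩
    exact ⟨⟨_, φ, rfl⟩, rfl, hval φ⟩

theorem Lp.tendsto_of_norm_sub_le {u : ℕ → L2} {v : L2} {N : ℝ → ℝ} (hN : MemLp N 2 volume)
    (h : ∀ n : ℕ, ∀ᵐ x, ‖u n x - v x‖ ≤ 1 / ((n : ℝ) + 1) * N x) :
    Tendsto u atTop (nhds v) := by
  rw [tendsto_iff_norm_sub_tendsto_zero]
  have h0 : Tendsto (fun n : ℕ => 1 / ((n : ℝ) + 1) * ‖hN.toLp N‖) atTop (nhds 0) := by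
    simpa using tendsto_one_div_add_atTop_nhds_zero_nat.mul_const ‖hN.toLp N‖
  refine squeeze_zero (fun _ => norm_nonneg _) (fun n => ?_) h0
  refine Lp.norm_le_mul_norm_of_ae_le_mul ?_
  filter_upwards [h n, Lp.coeFn_sub (u n) v, hN.coeFn_toLp] with x h1 h2 h3
  rw [h2, Pi.sub_apply, h3]
  exact h1.trans (mul_le_mul_of_nonneg_left (le_abs_self _) (by positivity))

/-- A smooth cutoff function, equal to `1` on `[-1, 1]`. -/
def cutoff : ContDiffBump (0 : ℝ) := ⟨1, 2, one_pos, one_lt_two⟩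

/-- After rescaling by $n+1$ this yields the rate $|x|/(n+1)$; the factor $|x|$ is absorbed by
Schwartz decay. -/
theorem abs_one_sub_cutoff_le (x : ℝ) : |1 - cutoff x| ≤ |x| := by
  rw [abs_of_nonneg (sub_nonneg.2 cutoff.le_one)]
  rcases le_or_gt |x| 1 with hx | hx
  · rw [cutoff.one_of_mem_closedBall (by simpa [cutoff] using hx)]
    simp
  · linarith [cutoff.nonneg (x := x)]

/-- The truncations $\chi(x/(n+1))f$ converge in graph norm: the derivative errors are at most
$|xf'|/(n+1)$ and $C|f|/(n+1)$, with $C$ a bound for the derivative of the cutoff. -/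
theorem schwartz_mem_closure_graph_pOp (K : ℝ) (f : 𝓢(ℝ, ℂ)) :
    (f.toLp 2 volume, (Complex.I / (K : ℂ)) • (SchwartzMap.derivCLM ℂ ℂ f).toLp 2 volume) ∈
      (pOp K).graph.topologicalClosure := by
  obtain ⟨C, hC⟩ : ∃ C, ∀ x, ‖deriv cutoff x‖ ≤ C :=
    ((cutoff.contDiff (n := ⊤)).continuous_deriv (by simp)).bounded_above_of_compact_support
      cutoff.hasCompactSupport.deriv
  have hr : ∀ n : ℕ, (0 : ℝ) < n + 1 := fun n => by positivity
  let χ : ℕ → ℝ → ℂ := fun n x => (cutoff (x / (n + 1)) : ℂ)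
  have hχ : ∀ n, ContDiff ℝ ∞ (χ n) := fun n =>
    Complex.ofRealCLM.contDiff.comp ((cutoff.contDiff (n := ⊤)).comp (contDiff_id.div_const _))
  have hχc : ∀ n, HasCompactSupport (χ n) := fun n => by
    have h1 : HasCompactSupport fun x : ℝ => cutoff (x / (n + 1)) := by
      have := cutoff.hasCompactSupport.comp_homeomorph
        (Homeomorph.mulRight₀ ((n : ℝ) + 1)⁻¹ (inv_ne_zero (hr n).ne'))
      simpa [Function.comp_def, div_eq_mul_inv] using this
    exact h1.comp_left (g := fun r : ℝ => (r : ℂ)) Complex.ofReal_zero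
  have hχd : ∀ n x, HasDerivAt (χ n) ((deriv cutoff (x / (n + 1)) * (1 / (n + 1)) : ℝ) : ℂ) x := by
    intro n x
    have h1 : HasDerivAt cutoff (deriv cutoff (x / (n + 1))) (x / (n + 1)) :=
      ((cutoff.contDiff (n := ⊤)).differentiable (by simp) _).hasDerivAt
    exact (h1.comp x ((hasDerivAt_id' x).div_const _)).ofReal_comp
  let φ : ℕ → testFunctions := fun n =>
    ⟨fun x => χ n x * f x, (hχ n).mul (f.smooth ⊤), (hχc n).mul_right⟩
  have hχ1 : ∀ n x, ‖χ n x - 1‖ ≤ 1 / ((n : ℝ) + 1) * |x| := by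
    intro n x
    have h1 := abs_one_sub_cutoff_le (x / (n + 1))
    rw [← Complex.ofReal_one, ← Complex.ofReal_sub, Complex.norm_real, Real.norm_eq_abs, abs_sub_comm]
    refine h1.trans (le_of_eq ?_)
    rw [abs_div, abs_of_pos (hr n)]
    ring
  have hx : ∀ g : 𝓢(ℝ, ℂ), MemLp (fun x : ℝ => |x| * ‖g x‖) 2 volume := by
    intro g
    have ht : (fun x : ℝ => x).HasTemperateGrowth := by fun_prop
    have h1 := ((SchwartzMap.smulLeftCLM ℂ (fun x : ℝ => x) g).memLp 2 volume).norm
    refine h1.congr_norm (by fun_prop) (Eventually.of_forall fun x => ?_)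
    simp [SchwartzMap.smulLeftCLM_apply_apply ht]
  have hφ0 : Tendsto (fun n => testToL2 (φ n)) atTop (nhds (f.toLp 2 volume)) := by
    refine Lp.tendsto_of_norm_sub_le (hx f) fun n => ?_
    filter_upwards [coeFn_testToL2 (φ n), f.coeFn_toLp 2 volume] with x h1 h2
    rw [h1, h2]
    change ‖χ n x * f x - f x‖ ≤ _
    rw [← sub_one_mul, norm_mul, ← mul_assoc]
    exact mul_le_mul_of_nonneg_right (hχ1 n x) (norm_nonneg _)
  have hφ1 : Tendsto (fun n => testDerivToL2 (φ n)) atTop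
      (nhds ((SchwartzMap.derivCLM ℂ ℂ f).toLp 2 volume)) := by
    refine Lp.tendsto_of_norm_sub_le ((hx (SchwartzMap.derivCLM ℂ ℂ f)).add
      ((f.memLp 2 volume).norm.const_mul C)) fun n => ?_
    filter_upwards [MemLp.coeFn_toLp (testFunctions_deriv_memLp (φ n).2),
      (SchwartzMap.derivCLM ℂ ℂ f).coeFn_toLp 2 volume] with x h1 h2
    have h3 : deriv (φ n).1 x =
        ((deriv cutoff (x / (n + 1)) * (1 / (n + 1)) : ℝ) : ℂ) * f x + χ n x * deriv f x :=
      ((hχd n x).mul f.differentiableAt.hasDerivAt).deriv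
    have h4 : testDerivToL2 (φ n) x = deriv (φ n).1 x := h1
    rw [h4, h2, h3, SchwartzMap.derivCLM_apply]
    have h5 : ((deriv cutoff (x / (n + 1)) * (1 / (n + 1)) : ℝ) : ℂ) * f x + χ n x * deriv f x
        - deriv f x = (χ n x - 1) * deriv f x +
        ((deriv cutoff (x / (n + 1)) * (1 / (n + 1)) : ℝ) : ℂ) * f x := by ring
    rw [h5]
    refine (norm_add_le _ _).trans ?_
    simp only [Pi.add_apply, SchwartzMap.derivCLM_apply]
    rw [mul_add, norm_mul, norm_mul, ← mul_assoc, ← mul_assoc]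
    refine add_le_add (mul_le_mul_of_nonneg_right (hχ1 n x) (norm_nonneg _))
      (mul_le_mul_of_nonneg_right ?_ (norm_nonneg _))
    rw [Complex.norm_real, norm_mul, mul_comm, Real.norm_of_nonneg (by positivity)]
    exact mul_le_mul_of_nonneg_left (hC _) (by positivity)
  rw [← SetLike.mem_coe, Submodule.topologicalClosure_coe]
  refine mem_closure_of_tendsto (hφ0.prodMk_nhds (hφ1.const_smul (Complex.I / (K : ℂ))))
    (Eventually.of_forall fun n => ?_)
  exact mem_graph_pOp_iff.2 ⟨φ n, rfl, rfl⟩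

/-- The multiplier of `p̄` in Fourier space. -/
def pSymbol (K k : ℝ) : ℝ := -(2 * Real.pi * k) / K

/-- The Fourier transform on `L²(ℝ)`. -/
abbrev fourierL2 : L2 ≃ₗᵢ[ℂ] L2 := Lp.fourierTransformₗᵢ ℝ ℂ

/-- The operator in `L²(ℝ)` that the Fourier transform turns into multiplication by `pSymbol K`. -/
def fourierMulOp (K : ℝ) : L2 →ₗ.[ℂ] L2 :=
  (mulOp volume (fun k => (pSymbol K k : ℂ))).transport fourierL2.symm

/-- The spectral representation of `fourierMulOp K` by the Fourier transform. -/
def fourierMulOpRepresentation (K : ℝ) : SpectralRepresentation (fourierMulOp K) where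
  Ω := ℝ
  mΩ := inferInstance
  μ := volume
  a := pSymbol K
  measurable_a := by unfold pSymbol; fun_prop
  U := fourierL2
  diagonalizes := rfl

theorem mem_graph_fourierMulOp_iff {K : ℝ} {x y : L2} : (x, y) ∈ (fourierMulOp K).graph ↔
    ⇑(fourierL2 y) =ᵐ[volume] fun k => (pSymbol K k : ℂ) * fourierL2 x k :=
  (fourierMulOpRepresentation K).mem_graph_iff

theorem fourierL2_toLp (f : 𝓢(ℝ, ℂ)) : fourierL2 (f.toLp 2 volume) = (𝓕 f).toLp 2 volume :=
  SchwartzMap.toLp_fourier_eq f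

/-- Differentiation becomes $2\pi ik$, and $\frac iK\cdot 2\pi ik=-\frac{2\pi k}K$ explains the sign
in `pSymbol`. -/
theorem schwartz_mem_graph_fourierMulOp (K : ℝ) (f : 𝓢(ℝ, ℂ)) :
    (f.toLp 2 volume, (Complex.I / (K : ℂ)) • (SchwartzMap.derivCLM ℂ ℂ f).toLp 2 volume) ∈
      (fourierMulOp K).graph := by
  rw [mem_graph_fourierMulOp_iff, map_smul, fourierL2_toLp, fourierL2_toLp]
  filter_upwards [(𝓕 f).coeFn_toLp 2 volume,
    (𝓕 (SchwartzMap.derivCLM ℂ ℂ f)).coeFn_toLp 2 volume,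
    Lp.coeFn_smul (Complex.I / (K : ℂ)) ((𝓕 (SchwartzMap.derivCLM ℂ ℂ f)).toLp 2 volume)]
    with k h1 h2 h3
  rw [h3, Pi.smul_apply, h1, h2, SchwartzMap.fourier_coe, SchwartzMap.fourier_coe]
  have h4 := congrFun (Real.fourier_deriv (f := (f : ℝ → ℂ)) f.integrable f.differentiable
    (SchwartzMap.derivCLM ℂ ℂ f).integrable) k
  have h5 : (⇑(SchwartzMap.derivCLM ℂ ℂ f)) = deriv f := rfl
  rw [h5, h4, pSymbol]
  simp only [smul_eq_mul]
  push_cast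
  linear_combination (2 * Real.pi * k * 𝓕 (f : ℝ → ℂ) k / K : ℂ) * Complex.I_mul_I

theorem pOp_le_fourierMulOp (K : ℝ) : pOp K ≤ fourierMulOp K := by
  refine LinearPMap.le_of_le_graph ?_
  rintro ⟨x, y⟩ h
  obtain ⟨φ, rfl, rfl⟩ := mem_graph_pOp_iff.1 h
  exact schwartz_mem_graph_fourierMulOp K (testToSchwartz φ)

theorem fourierMulOp_isClosed (K : ℝ) : (fourierMulOp K).IsClosed :=
  LinearPMap.transport_isClosed (mulOp_isClosed _) _

/-- Core argument. Write $T$ for the multiplier operator and approximate the transform of $(T+i)x$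
by a test function $\psi$. Dividing $\psi$ by the smooth, nowhere zero function `pSymbol` $+\,i$
gives another test function, whose inverse transform is a Schwartz function $g$ with $(T+i)g$ close
to $(T+i)x$. -/
theorem graph_fourierMulOp_le (K : ℝ) :
    (fourierMulOp K).graph ≤ (pOp K).graph.topologicalClosure := by
  rintro ⟨x, y⟩ h
  have hcl : (pOp K).graph.topologicalClosure =
      ((pOp K).graph.topologicalClosure).topologicalClosure :=
    ((pOp K).graph.isClosed_topologicalClosure.submodule_topologicalClosure_eq).symm
  rw [hcl, ← SetLike.mem_coe, Submodule.topologicalClosure_coe, Metric.mem_closure_iff]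
  intro ε hε
  obtain ⟨_, ⟨ψ, rfl⟩, hψ⟩ := Metric.mem_closure_iff.1
    (dense_range_testToL2 (fourierL2 (y + Complex.I • x))) ε hε
  have hne : ∀ k, (pSymbol K k : ℂ) + Complex.I ≠ 0 := fun k h0 => by
    simpa using congrArg Complex.im h0
  have hsm : ContDiff ℝ ∞ fun k => (pSymbol K k : ℂ) + Complex.I := by
    have h1 : ContDiff ℝ ∞ (pSymbol K) := by unfold pSymbol; fun_prop
    exact (Complex.ofRealCLM.contDiff.comp h1).add contDiff_const
  let φ : testFunctions := ⟨fun k => ((pSymbol K k : ℂ) + Complex.I)⁻¹ * ψ.1 k,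
    (hsm.inv hne).mul ψ.2.1, ψ.2.2.mul_left⟩
  let g : 𝓢(ℝ, ℂ) := 𝓕⁻ (testToSchwartz φ)
  have hg := schwartz_mem_graph_fourierMulOp K g
  have hFg : fourierL2 (g.toLp 2 volume) = testToL2 φ := by
    rw [fourierL2_toLp, testToL2_eq_toLp, FourierTransform.fourier_fourierInv_eq]
  set x' : L2 := g.toLp 2 volume
  set y' : L2 := (Complex.I / (K : ℂ)) • (SchwartzMap.derivCLM ℂ ℂ g).toLp 2 volume
  have hψ' : fourierL2 (y' + Complex.I • x') = testToL2 ψ := by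
    refine Lp.ext ?_
    rw [map_add, fourierL2.map_smul Complex.I x', hFg]
    have h1 := mem_graph_fourierMulOp_iff.1 hg
    rw [hFg] at h1
    filter_upwards [Lp.coeFn_add (fourierL2 y') (Complex.I • testToL2 φ),
      Lp.coeFn_smul Complex.I (testToL2 φ), h1, coeFn_testToL2 φ, coeFn_testToL2 ψ]
      with k h1 h2 h3 h4 h5
    rw [h1, Pi.add_apply, h2, Pi.smul_apply, h3, h4, h5]
    change (pSymbol K k : ℂ) * (((pSymbol K k : ℂ) + Complex.I)⁻¹ * ψ.1 k) +
      Complex.I * (((pSymbol K k : ℂ) + Complex.I)⁻¹ * ψ.1 k) = ψ.1 k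
    rw [← add_mul, mul_inv_cancel_left₀ (hne k)]
  refine ⟨(x', y'), schwartz_mem_closure_graph_pOp K g, ?_⟩
  have hlt : ‖(y - y') + Complex.I • (x - x')‖ < ε := by
    rw [← hψ', fourierL2.dist_map, dist_eq_norm] at hψ
    rwa [show y - y' + Complex.I • (x - x') = y + Complex.I • x - (y' + Complex.I • x') by
      rw [smul_sub]; abel]
  have hrel := (fourierMulOpRepresentation K).mem_graph_iff.1
    ((fourierMulOp K).graph.sub_mem h hg)
  have h2 := hrel.add_fun
    ((SpectralRepresentation.rel_one (x - x')).smul_fun Complex.I)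
  -- $|k+i|$ dominates both $1$ and $|k|$, so smallness of $(T+i)(x-x')$ controls both components of
  -- the graph.
  have hn : ∀ k : ℝ, ‖(k : ℂ) + Complex.I * 1‖ ^ 2 = k ^ 2 + 1 := fun k => by
    rw [← Complex.normSq_eq_norm_sq, Complex.normSq_apply]; simp; ring
  rw [dist_eq_norm, Prod.norm_def]
  refine max_lt ?_ ?_
  · refine ((SpectralRepresentation.rel_one (x - x')).norm_le h2 fun k => ?_).trans_lt hlt
    refine le_of_sq_le_sq ?_ (norm_nonneg _)
    rw [hn]; simp; positivity
  · refine (hrel.norm_le h2 fun k => ?_).trans_lt hlt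
    refine le_of_sq_le_sq ?_ (norm_nonneg _)
    rw [hn]; simp

theorem pOp_isClosable (K : ℝ) : (pOp K).IsClosable :=
  (fourierMulOp_isClosed K).isClosable.leIsClosable (pOp_le_fourierMulOp K)

theorem pBar_eq_fourierMulOp (K : ℝ) : pBar K = fourierMulOp K := by
  refine LinearPMap.eq_of_eq_graph ?_
  rw [pBar, ← (pOp_isClosable K).graph_closure_eq_closure_graph]
  refine le_antisymm ?_ (graph_fourierMulOp_le K)
  exact Submodule.topologicalClosure_minimal _
    (LinearPMap.le_graph_of_le (pOp_le_fourierMulOp K)) (fourierMulOp_isClosed K)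

/-- The spectral representation of `p̄` by the Fourier transform. -/
def pBarRepresentation (K : ℝ) : SpectralRepresentation (pBar K) where
  Ω := ℝ
  mΩ := inferInstance
  μ := volume
  a := pSymbol K
  measurable_a := (fourierMulOpRepresentation K).measurable_a
  U := fourierL2
  diagonalizes := (pBar_eq_fourierMulOp K).symm

/-- Applied twice, this puts test functions into the domain of $\bar p^2$, as `Rel.cos_congr` and
`Rel.sinc_congr` require. -/
theorem test_mem_graph_pBar (K : ℝ) (φ : testFunctions) :
    ∃ ψ : testFunctions, (testToL2 φ, testToL2 ψ) ∈ (pBar K).graph := by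
  refine ⟨(Complex.I / (K : ℂ)) • ⟨deriv φ.1,
    (contDiff_infty_iff_deriv.1 φ.2.1).2, φ.2.2.deriv⟩, ?_⟩
  refine LinearPMap.le_graph_of_le (LinearPMap.le_closure (pOp K)) ?_
  exact mem_graph_pOp_iff.2 ⟨φ, rfl, by rw [map_smul]; rfl⟩

/-! ### Convolution operators in `L²(ℝ)` -/

section Convolution

open scoped ENNReal

/-- Cauchy–Schwarz for the product $\sqrt a\cdot(\sqrt a\,b)$. -/
theorem ENNReal.sq_lintegral_mul_le {α : Type u} [MeasurableSpace α] {μ : Measure α}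
    {a b : α → ℝ≥0∞} (ha : AEMeasurable a μ) (hb : AEMeasurable b μ) :
    (∫⁻ t, a t * b t ∂μ) ^ 2 ≤ (∫⁻ t, a t ∂μ) * ∫⁻ t, a t * b t ^ 2 ∂μ := by
  have hs : ∀ x : ℝ≥0∞, x ^ (1 / 2 : ℝ) * x ^ (1 / 2 : ℝ) = x := fun x => by
    rw [← ENNReal.rpow_add_of_nonneg _ _ (by norm_num) (by norm_num)]; norm_num
  have hs' : ∀ x : ℝ≥0∞, (x ^ (1 / 2 : ℝ)) ^ (2 : ℕ) = x := fun x => by rw [sq, hs]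
  have h := ENNReal.lintegral_mul_le_Lp_mul_Lq μ Real.HolderConjugate.two_two
    (f := fun t => a t ^ (1 / 2 : ℝ)) (g := fun t => a t ^ (1 / 2 : ℝ) * b t)
    (ha.pow_const _) ((ha.pow_const _).mul hb)
  simp only [Pi.mul_apply, ← mul_assoc, hs, ENNReal.rpow_ofNat, mul_pow, hs'] at h
  calc (∫⁻ t, a t * b t ∂μ) ^ 2 ≤ _ := pow_le_pow_left' h 2
    _ = _ := by rw [mul_pow, hs', hs']

/-- Cauchy–Schwarz with weight $|k|$, then Tonelli and translation invariance. -/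
theorem lintegral_enorm_convolution_sq_le {k f : ℝ → ℂ} (hk : Measurable k) (hf : Measurable f) :
    ∫⁻ x, ‖convolution k f (ContinuousLinearMap.mul ℂ ℂ) volume x‖ₑ ^ 2 ≤
      (∫⁻ t, ‖k t‖ₑ) ^ 2 * ∫⁻ x, ‖f x‖ₑ ^ 2 := by
  calc ∫⁻ x, ‖convolution k f (ContinuousLinearMap.mul ℂ ℂ) volume x‖ₑ ^ 2
      ≤ ∫⁻ x, (∫⁻ t, ‖k t‖ₑ) * ∫⁻ t, ‖k t‖ₑ * ‖f (x - t)‖ₑ ^ 2 := by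
        refine lintegral_mono fun x => ?_
        refine le_trans ?_ (ENNReal.sq_lintegral_mul_le (by fun_prop) (by fun_prop))
        refine pow_le_pow_left' ((enorm_integral_le_lintegral_enorm _).trans (le_of_eq ?_)) 2
        simp
    _ = (∫⁻ t, ‖k t‖ₑ) * ∫⁻ t, ∫⁻ x, ‖k t‖ₑ * ‖f (x - t)‖ₑ ^ 2 := by
        rw [lintegral_const_mul _ (by fun_prop), lintegral_lintegral_swap (by fun_prop)]
    _ = (∫⁻ t, ‖k t‖ₑ) ^ 2 * ∫⁻ x, ‖f x‖ₑ ^ 2 := by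
        have h : ∀ t : ℝ, ∫⁻ x, ‖k t‖ₑ * ‖f (x - t)‖ₑ ^ 2 = ‖k t‖ₑ * ∫⁻ x, ‖f x‖ₑ ^ 2 := by
          intro t
          rw [lintegral_const_mul _ (by fun_prop),
            lintegral_sub_right_eq_self (fun x => ‖f x‖ₑ ^ 2)]
        simp_rw [h]
        rw [lintegral_mul_const _ (by fun_prop), sq, mul_assoc]

/-- Young's inequality for the convolution of an `L¹` function with an `L²` function. -/
theorem eLpNorm_convolution_le {k f : ℝ → ℂ} (hk : Measurable k) (hf : Measurable f) :
    eLpNorm (convolution k f (ContinuousLinearMap.mul ℂ ℂ) volume) 2 volume ≤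
      (∫⁻ t, ‖k t‖ₑ) * eLpNorm f 2 volume := by
  rw [eLpNorm_eq_lintegral_rpow_enorm_toReal (by simp) (by simp),
    eLpNorm_eq_lintegral_rpow_enorm_toReal (by simp) (by simp)]
  simp only [ENNReal.toReal_ofNat, ENNReal.rpow_ofNat]
  refine (ENNReal.rpow_le_rpow (lintegral_enorm_convolution_sq_le hk hf) (by norm_num)).trans
    (le_of_eq ?_)
  rw [ENNReal.mul_rpow_of_nonneg _ _ (by norm_num), ← ENNReal.rpow_ofNat, ← ENNReal.rpow_mul]
  norm_num

/-- Requiring $k\in L^2$ as well as $L^1$ gives existence at every point, so that additivity in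
`convL2` holds pointwise. -/
theorem convolutionExists_of_memLp {k f : ℝ → ℂ} (hk : MemLp k 2 volume) (hf : MemLp f 2 volume) :
    ConvolutionExists k f (ContinuousLinearMap.mul ℂ ℂ) volume := fun x =>
  hk.integrable_mul (hf.comp_measurePreserving
    (Measure.measurePreserving_sub_left volume x))

theorem memLp_convolution {k f : ℝ → ℂ} (hk : Measurable k) (hk1 : Integrable k)
    (hf : Measurable f) (hf2 : MemLp f 2 volume) :
    MemLp (convolution k f (ContinuousLinearMap.mul ℂ ℂ) volume) 2 volume := by
  refine ⟨?_, (eLpNorm_convolution_le hk hf).trans_lt ?_⟩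
  · exact (hk.aestronglyMeasurable.convolution_integrand (ContinuousLinearMap.mul ℂ ℂ)
      hf.aestronglyMeasurable (μ := volume) (ν := volume)).integral_prod_right'
  · exact ENNReal.mul_lt_top hk1.2 hf2.2

/-- Convolution with `k ∈ L¹ ∩ L²`, as a bounded operator in `L²(ℝ)`. -/
def convL2 (k : ℝ → ℂ) (hk : Measurable k) (hk1 : Integrable k) (hk2 : MemLp k 2 volume) :
    L2 →L[ℂ] L2 :=
  LinearMap.mkContinuous
    { toFun := fun f => (memLp_convolution hk hk1 (Lp.stronglyMeasurable f).measurable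
        (Lp.memLp f)).toLp _
      map_add' := fun f g => by
        rw [← MemLp.toLp_add]
        refine MemLp.toLp_congr _ _ (Eventually.of_forall fun x => ?_)
        rw [convolution_congr _ (ae_eq_refl k) (Lp.coeFn_add f g)]
        exact (convolutionExists_of_memLp hk2 (Lp.memLp f) x).distrib_add
          (convolutionExists_of_memLp hk2 (Lp.memLp g) x)
      map_smul' := fun c f => by
        rw [RingHom.id_apply, ← MemLp.toLp_const_smul]
        refine MemLp.toLp_congr _ _ (Eventually.of_forall fun x => ?_)
        rw [convolution_congr _ (ae_eq_refl k) (Lp.coeFn_smul c f)]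
        exact congrFun convolution_smul x }
    (∫⁻ t, ‖k t‖ₑ).toReal fun f => by
      change ‖MemLp.toLp _ (memLp_convolution hk hk1 (Lp.stronglyMeasurable f).measurable
        (Lp.memLp f))‖ ≤ _
      rw [Lp.norm_toLp, Lp.norm_def, ← ENNReal.toReal_mul]
      exact ENNReal.toReal_mono (ENNReal.mul_lt_top hk1.2 (Lp.memLp f).2).ne
        (eLpNorm_convolution_le hk (Lp.stronglyMeasurable f).measurable)

theorem coeFn_convL2 {k : ℝ → ℂ} (hk : Measurable k) (hk1 : Integrable k)
    (hk2 : MemLp k 2 volume) (f : L2) : ⇑(convL2 k hk hk1 hk2 f) =ᵐ[volume]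
      convolution k f (ContinuousLinearMap.mul ℂ ℂ) volume :=
  MemLp.coeFn_toLp (memLp_convolution hk hk1 (Lp.stronglyMeasurable f).measurable (Lp.memLp f))

end Convolution

/-- The translation `f ↦ f(· + c)` in `L²(ℝ)`. -/
def shiftL2 (c : ℝ) : L2 →L[ℂ] L2 :=
  (Lp.compMeasurePreservingₗᵢ ℂ (fun x : ℝ => x + c)
    (measurePreserving_add_right volume c)).toContinuousLinearMap

theorem coeFn_shiftL2 (c : ℝ) (f : L2) : ⇑(shiftL2 c f) =ᵐ[volume] fun x => f (x + c) :=
  Lp.coeFn_compMeasurePreserving f (measurePreserving_add_right volume c)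

/-! ### The operators `cos(τ p̄)` and `sin(τ p̄) / p̄` -/

theorem coeFn_fourierL2_testToL2 (φ : testFunctions) :
    ⇑(fourierL2 (testToL2 φ)) =ᵐ[volume] 𝓕 φ.1 := by
  rw [testToL2_eq_toLp, fourierL2_toLp]
  exact (𝓕 (testToSchwartz φ)).coeFn_toLp 2 volume

theorem fourier_comp_add_right (φ : ℝ → ℂ) (c k : ℝ) :
    𝓕 (fun x => φ (x + c)) k = Complex.exp (Complex.I * (2 * Real.pi * c * k : ℝ)) * 𝓕 φ k := by
  have h := congrFun (VectorFourier.fourierIntegral_comp_add_right Real.fourierChar volume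
    (innerₗ ℝ) φ c) k
  refine h.trans ?_
  rw [Circle.smul_def, smul_eq_mul, Real.fourierChar_apply]
  congr 2
  simp
  ring

theorem fourierL2_shiftL2_testToL2 (c : ℝ) (φ : testFunctions) :
    ⇑(fourierL2 (shiftL2 c (testToL2 φ))) =ᵐ[volume] fun k =>
      Complex.exp (Complex.I * (2 * Real.pi * c * k : ℝ)) * fourierL2 (testToL2 φ) k := by
  let ψ : testFunctions := ⟨fun x => φ.1 (x + c), φ.2.1.comp (contDiff_id.add contDiff_const),
    φ.2.2.comp_homeomorph (Homeomorph.addRight c)⟩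
  have h : shiftL2 c (testToL2 φ) = testToL2 ψ := rfl
  rw [h]
  filter_upwards [coeFn_fourierL2_testToL2 φ, coeFn_fourierL2_testToL2 ψ] with k h1 h2
  rw [h1, h2]
  exact fourier_comp_add_right φ.1 c k

/-- For $r=|\tau|/K$ this is $\frac2K|\tau|\,\mathrm{sinc}(\tau\cdot\,$`pSymbol K k`$)$, the source
of the prefactor $\frac K2\operatorname{sgn}\tau$. -/
theorem fourier_indicator_Icc {r : ℝ} (hr : 0 ≤ r) (k : ℝ) :
    𝓕 ((Set.Icc (-r) r).indicator fun _ => (1 : ℂ)) k =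
      ((2 * r * Real.sinc (2 * Real.pi * r * k) : ℝ) : ℂ) := by
  rw [Real.fourier_real_eq_integral_exp_smul]
  have h1 : ∀ v : ℝ, Complex.exp ((-2 * Real.pi * v * k : ℝ) * Complex.I) •
      (Set.Icc (-r) r).indicator (fun _ => (1 : ℂ)) v = (Set.Icc (-r) r).indicator
      (fun v : ℝ => Complex.exp (((-2 * Real.pi * k) * v : ℝ) * Complex.I)) v := by
    intro v
    by_cases hv : v ∈ Set.Icc (-r) r
    · simp only [Set.indicator_of_mem hv, smul_eq_mul, mul_one]
      congr 3; ring
    · simp [Set.indicator_of_notMem hv]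
  simp_rw [h1]
  rw [integral_indicator measurableSet_Icc, integral_Icc_eq_integral_Ioc,
    ← intervalIntegral.integral_of_le (by linarith)]
  rcases eq_or_ne k 0 with rfl | hk
  · simp [two_mul]
  have hc : -2 * Real.pi * k ≠ 0 := by simp [hk, Real.pi_ne_zero]
  rw [intervalIntegral.integral_comp_mul_left
    (fun x : ℝ => Complex.exp ((x : ℂ) * Complex.I)) hc, mul_neg, integral_exp_mul_I_eq_sinc,
    show -2 * Real.pi * k * r = -(2 * Real.pi * r * k) by ring, Real.sinc_neg, Complex.real_smul]
  have hk' : (k : ℂ) ≠ 0 := by exact_mod_cast hk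
  have hp : (Real.pi : ℂ) ≠ 0 := by exact_mod_cast Real.pi_ne_zero
  push_cast
  field_simp

theorem integrable_indicator_Icc {k : ℝ → ℂ} (hk : Continuous k) (r : ℝ) :
    Integrable ((Set.Icc (-r) r).indicator k) :=
  (hk.continuousOn.integrableOn_Icc).integrable_indicator measurableSet_Icc

theorem memLp_indicator_Icc {k : ℝ → ℂ} (hk : Continuous k) (r : ℝ) :
    MemLp ((Set.Icc (-r) r).indicator k) 2 volume := by
  have hc : HasCompactSupport ((Set.Icc (-r) r).indicator k) :=
    HasCompactSupport.intro isCompact_Icc fun x hx => Set.indicator_of_notMem hx _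
  obtain ⟨C, hC⟩ := (isCompact_Icc (a := -r) (b := r)).exists_bound_of_continuousOn hk.continuousOn
  refine hc.memLp_of_bound (hk.measurable.indicator measurableSet_Icc).aestronglyMeasurable |C|
    (Eventually.of_forall fun x => ?_)
  by_cases hx : x ∈ Set.Icc (-r) r
  · rw [Set.indicator_of_mem hx]
    exact (hC x hx).trans (le_abs_self C)
  · rw [Set.indicator_of_notMem hx, norm_zero]
    exact abs_nonneg C

/-- Convolution with the restriction of `k` to `[-r, r]`, as a bounded operator in `L²(ℝ)`. -/
def convIcc (k : ℝ → ℂ) (hk : Continuous k) (r : ℝ) : L2 →L[ℂ] L2 :=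
  convL2 ((Set.Icc (-r) r).indicator k) (hk.measurable.indicator measurableSet_Icc)
    (integrable_indicator_Icc hk r) (memLp_indicator_Icc hk r)

theorem coeFn_convIcc {k : ℝ → ℂ} (hk : Continuous k) (r : ℝ) (f : L2) :
    ⇑(convIcc k hk r f) =ᵐ[volume]
      convolution ((Set.Icc (-r) r).indicator k) f (ContinuousLinearMap.mul ℂ ℂ) volume :=
  coeFn_convL2 _ _ _ f

/-- The convolution is again a test function, so its $L^2$ transform is the Fourier integral and the
$L^1$ convolution theorem applies. -/
theorem fourierL2_convIcc_testToL2 {r : ℝ} (hr : 0 ≤ r) (φ : testFunctions) :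
    ⇑(fourierL2 (convIcc (fun _ => 1) continuous_const r (testToL2 φ))) =ᵐ[volume] fun k =>
      ((2 * r * Real.sinc (2 * Real.pi * r * k) : ℝ) : ℂ) * fourierL2 (testToL2 φ) k := by
  have hi := integrable_indicator_Icc (k := fun _ => (1 : ℂ)) continuous_const r
  have hc : HasCompactSupport ((Set.Icc (-r) r).indicator fun _ => (1 : ℂ)) :=
    HasCompactSupport.intro isCompact_Icc fun x hx => Set.indicator_of_notMem hx _
  let ψ : testFunctions := ⟨convolution ((Set.Icc (-r) r).indicator fun _ => (1 : ℂ)) φ.1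
    (ContinuousLinearMap.mul ℂ ℂ) volume,
    φ.2.2.contDiff_convolution_right (ContinuousLinearMap.mul ℝ ℂ) hi.locallyIntegrable
      (n := ⊤) φ.2.1, hc.convolution _ φ.2.2⟩
  have h : convIcc (fun _ => 1) continuous_const r (testToL2 φ) = testToL2 ψ := by
    refine Lp.ext ((coeFn_convIcc _ _ _).trans (Filter.EventuallyEq.trans ?_ (coeFn_testToL2 ψ).symm))
    rw [convolution_congr _ (ae_eq_refl _) (coeFn_testToL2 φ)]
  rw [h]
  filter_upwards [coeFn_fourierL2_testToL2 φ, coeFn_fourierL2_testToL2 ψ] with k h1 h2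
  rw [h1, h2, ← fourier_indicator_Icc hr]
  exact Real.fourier_mul_convolution_eq hi (φ.2.1.continuous.integrable_of_hasCompactSupport φ.2.2) k

theorem nonempty_pBarRepresentation (K : ℝ) : Nonempty (SpectralRepresentation (pBar K)) :=
  ⟨pBarRepresentation K⟩

theorem cosOp_eq (K τ : ℝ) : cosOp K τ =
    (((1 / 2 : ℂ) • (shiftL2 (τ / K) + shiftL2 (-(τ / K))) : L2 →L[ℂ] L2) :
      L2 →ₗ[ℂ] L2).toPMap ⊤ := by
  refine funcCalc_eq_toPMap (nonempty_pBarRepresentation K) fun R =>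
    R.apply_eq_toPMap _ dense_range_testToL2 ?_
  rintro _ ⟨φ, rfl⟩
  obtain ⟨ψ, hψ⟩ := test_mem_graph_pBar K φ
  obtain ⟨θ, hθ⟩ := test_mem_graph_pBar K ψ
  -- The symbol is negative for $k>0$, so $e^{it\bar p}$ shifts by $-t/K$; averaging over $\pm\tau$
  -- makes the sign immaterial.
  have hs : ∀ t : ℝ, (pBarRepresentation K).Rel
      (fun k => Complex.exp (Complex.I * (t * k : ℝ))) (testToL2 φ)
      (shiftL2 (-(t / K)) (testToL2 φ)) := by
    intro t
    have e : ∀ k : ℝ, 2 * Real.pi * -(t / K) * k = t * pSymbol K k := fun k => by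
      unfold pSymbol; ring
    filter_upwards [fourierL2_shiftL2_testToL2 (-(t / K)) φ] with k hk
    refine hk.trans ?_
    exact congrArg (fun r : ℝ => Complex.exp (Complex.I * r) * fourierL2 (testToL2 φ) k) (e k)
  have h := ((hs τ).add_fun (hs (-τ))).smul_fun (1 / 2)
  have h' := (h.congr_fun fun k => (SpectralRepresentation.cos_eq_exp τ k).symm).cos_congr
    (R' := R) hψ hθ
  rw [neg_div, neg_neg, add_comm] at h'
  exact h'

theorem sinDivOp_eq {K : ℝ} (hK : 0 < K) (τ : ℝ) : sinDivOp K τ =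
    (((((K / 2 * Real.sign τ : ℝ) : ℂ) • convIcc (fun _ => 1) continuous_const (|τ| / K)) :
      L2 →L[ℂ] L2) : L2 →ₗ[ℂ] L2).toPMap ⊤ := by
  refine funcCalc_eq_toPMap (nonempty_pBarRepresentation K) fun R =>
    R.apply_eq_toPMap _ dense_range_testToL2 ?_
  rintro _ ⟨φ, rfl⟩
  obtain ⟨ψ, hψ⟩ := test_mem_graph_pBar K φ
  obtain ⟨θ, hθ⟩ := test_mem_graph_pBar K ψ
  refine SpectralRepresentation.Rel.sinc_congr (R := pBarRepresentation K) hψ hθ ?_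
  have h0 := fourierL2_convIcc_testToL2 (r := |τ| / K) (by positivity) φ
  unfold SpectralRepresentation.Rel
  change ⇑(fourierL2 _) =ᵐ[volume] fun k =>
    ((τ * Real.sinc (τ * pSymbol K k) : ℝ) : ℂ) * fourierL2 (testToL2 φ) k
  rw [smul_apply, map_smul]
  filter_upwards [h0, Lp.coeFn_smul ((K / 2 * Real.sign τ : ℝ) : ℂ)
    (fourierL2 (convIcc (fun _ => 1) continuous_const (|τ| / K) (testToL2 φ)))] with k h1 h2
  rw [h2, Pi.smul_apply, h1, smul_eq_mul, ← mul_assoc, ← Complex.ofReal_mul]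
  congr 2
  -- The sign of $\tau$ restores the odd factor, while evenness of sinc disposes of the sign in its
  -- argument. At $\tau=0$ both operators vanish.
  have h3 : Real.sign τ * |τ| = τ := by
    rcases lt_trichotomy τ 0 with h | h | h
    · rw [Real.sign_of_neg h, abs_of_neg h]; ring
    · simp [h]
    · rw [Real.sign_of_pos h, abs_of_pos h]; ring
  have h4 : Real.sinc (2 * Real.pi * (|τ| / K) * k) = Real.sinc (τ * pSymbol K k) := by
    rw [pSymbol]
    rcases abs_choice τ with h | h <;> rw [h]
    · rw [← Real.sinc_neg]; congr 1; ring
    · congr 1; ring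
  rw [h4]
  calc K / 2 * Real.sign τ * (2 * (|τ| / K) * Real.sinc (τ * pSymbol K k))
      = (Real.sign τ * |τ|) * Real.sinc (τ * pSymbol K k) := by field_simp
    _ = _ := by rw [h3]

/-! ### The conjugated operators -/

section MaxComp

variable {E : Type u} {F : Type v} {G : Type w}
  [NormedAddCommGroup E] [InnerProductSpace ℂ E]
  [NormedAddCommGroup F] [InnerProductSpace ℂ F]
  [NormedAddCommGroup G] [InnerProductSpace ℂ G]

theorem LinearPMap.mem_graph_maxComp_iff {S : F →ₗ.[ℂ] G} {T : E →ₗ.[ℂ] F} {x : E} {y : G} :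
    (x, y) ∈ (S.maxComp T).graph ↔ ∃ z, (x, z) ∈ T.graph ∧ (z, y) ∈ S.graph := by
  simp only [LinearPMap.mem_graph_iff]
  constructor
  · rintro ⟨⟨x, hx, hx'⟩, rfl, h⟩
    exact ⟨_, ⟨⟨x, hx⟩, rfl, rfl⟩, ⟨⟨_, hx'⟩, rfl, h⟩⟩
  · rintro ⟨_, ⟨⟨x, hx⟩, rfl, rfl⟩, ⟨⟨z, hz⟩, rfl, h⟩⟩
    exact ⟨⟨x, hx, hz⟩, rfl, h⟩

end MaxComp

theorem mem_graph_BConj_toPMap_iff {K : ℝ} {T : L2 →L[ℂ] L2} {x y : L2} :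
    (x, y) ∈ (BConj K ((T : L2 →ₗ[ℂ] L2).toPMap ⊤)).graph ↔
      ∃ z : L2, (⇑z =ᵐ[volume] fun ξ => (Real.exp (-(K * ξ)) : ℂ) * x ξ) ∧
        ⇑y =ᵐ[volume] fun ξ => (Real.exp (K * ξ) : ℂ) * T z ξ := by
  rw [BConj, LinearPMap.mem_graph_maxComp_iff]
  constructor
  · rintro ⟨u, hu, huy⟩
    obtain ⟨z, hz, hzu⟩ := LinearPMap.mem_graph_maxComp_iff.1 hu
    rw [LinearPMap.mem_graph_toPMap_top_iff] at hzu
    subst hzu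
    exact ⟨z, mem_graph_mulOp_iff.1 hz, mem_graph_mulOp_iff.1 huy⟩
  · rintro ⟨z, hz, hy⟩
    exact ⟨T z, LinearPMap.mem_graph_maxComp_iff.2 ⟨z, mem_graph_mulOp_iff.2 hz,
      LinearPMap.mem_graph_toPMap_top_iff.2 rfl⟩, mem_graph_mulOp_iff.2 hy⟩

/-- If `e^{-Kξ} D = T e^{-Kξ}` on the domain of `B^{1/2}`, then `B^{-1/2} T B^{1/2}` is densely
defined and closable, with closure `D`. -/
theorem BConj_closure_eq {K : ℝ} {T D : L2 →L[ℂ] L2}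
    (h : ∀ x z : L2, (⇑z =ᵐ[volume] fun ξ => (Real.exp (-(K * ξ)) : ℂ) * x ξ) →
      ⇑(T z) =ᵐ[volume] fun ξ => (Real.exp (-(K * ξ)) : ℂ) * D x ξ) :
    Dense ((BConj K ((T : L2 →ₗ[ℂ] L2).toPMap ⊤)).domain : Set L2) ∧
      (BConj K ((T : L2 →ₗ[ℂ] L2).toPMap ⊤)).IsClosable ∧
      (BConj K ((T : L2 →ₗ[ℂ] L2).toPMap ⊤)).closure = (D : L2 →ₗ[ℂ] L2).toPMap ⊤ := by
  set A := BConj K ((T : L2 →ₗ[ℂ] L2).toPMap ⊤) with hA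
  -- Multiplication by $e^{-K\xi}$ preserves test functions, so they lie in the maximal domain; this
  -- gives density of the domain.
  have htest : ∀ φ, (testToL2 φ, D (testToL2 φ)) ∈ A.graph := by
    intro φ
    let ψ : testFunctions := ⟨fun ξ => (Real.exp (-(K * ξ)) : ℂ) * φ.1 ξ,
      (Complex.ofRealCLM.contDiff.comp (by fun_prop :
        ContDiff ℝ ∞ fun ξ : ℝ => Real.exp (-(K * ξ)))).mul φ.2.1, φ.2.2.mul_left⟩
    have hψ : ⇑(testToL2 ψ) =ᵐ[volume] fun ξ => (Real.exp (-(K * ξ)) : ℂ) * testToL2 φ ξ := by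
      filter_upwards [coeFn_testToL2 ψ, coeFn_testToL2 φ] with ξ h1 h2
      rw [h1, h2]
    refine mem_graph_BConj_toPMap_iff.2 ⟨testToL2 ψ, hψ, ?_⟩
    filter_upwards [h _ _ hψ] with ξ h1
    rw [h1, exp_mul_exp_neg_mul]
  -- The bounded $D$ is a closed extension, which gives closability and one inclusion for the
  -- closure; continuity of $D$ and density of test functions give the other.
  have hle : A ≤ (D : L2 →ₗ[ℂ] L2).toPMap ⊤ := by
    refine LinearPMap.le_of_le_graph ?_
    rintro ⟨x, y⟩ hxy
    obtain ⟨z, hz, hy⟩ := mem_graph_BConj_toPMap_iff.1 hxy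
    rw [LinearPMap.mem_graph_toPMap_top_iff]
    refine Lp.ext ?_
    filter_upwards [h x z hz, hy] with ξ h1 h2
    rw [h2, h1, exp_mul_exp_neg_mul]
    rfl
  have hD := LinearPMap.toPMap_top_isClosed D
  have hcl : A.IsClosable := hD.isClosable.leIsClosable hle
  refine ⟨dense_range_testToL2.mono ?_, hcl, ?_⟩
  · rintro _ ⟨φ, rfl⟩
    exact LinearPMap.mem_domain_of_mem_graph (htest φ)
  · refine LinearPMap.eq_of_eq_graph ?_
    rw [← hcl.graph_closure_eq_closure_graph]
    refine le_antisymm (Submodule.topologicalClosure_minimal _ (LinearPMap.le_graph_of_le hle) hD) ?_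
    rintro ⟨x, y⟩ hxy
    obtain rfl : D x = y := LinearPMap.mem_graph_toPMap_top_iff.1 hxy
    have hc : IsClosed {x | (x, D x) ∈ (A.graph.topologicalClosure : Set (L2 × L2))} :=
      A.graph.isClosed_topologicalClosure.preimage (by fun_prop)
    refine hc.closure_subset_iff.2 ?_ (dense_range_testToL2 x)
    rintro _ ⟨φ, rfl⟩
    exact A.graph.le_topologicalClosure (htest φ)

/-! ### Conjugation by $V$ and translations. -/

/-- The bounded operator `V D V⁻¹`. -/
def conjVIso (K : ℝ) (D : L2 →L[ℂ] L2) : WeightedL2 K →L[ℂ] WeightedL2 K :=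
  (VIso K).toContinuousLinearEquiv.toContinuousLinearMap ∘L D ∘L
    (VIso K).symm.toContinuousLinearEquiv.toContinuousLinearMap

theorem transport_VIso_toPMap (K : ℝ) (D : L2 →L[ℂ] L2) :
    ((D : L2 →ₗ[ℂ] L2).toPMap ⊤).transport (VIso K) =
      (conjVIso K D).toLinearMap.toPMap ⊤ := by
  refine LinearPMap.eq_of_eq_graph (SetLike.ext fun p => ?_)
  obtain ⟨x, y⟩ := p
  rw [LinearPMap.mem_graph_transport_iff, LinearPMap.mem_graph_toPMap_top_iff,
    LinearPMap.mem_graph_toPMap_top_iff]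
  change D ((VIso K).symm x) = (VIso K).symm y ↔ VIso K (D ((VIso K).symm x)) = y
  constructor
  · intro h
    rw [h, LinearIsometryEquiv.apply_symm_apply]
  · rintro rfl
    rw [LinearIsometryEquiv.symm_apply_apply]

theorem coeFn_conjVIso (K : ℝ) (D : L2 →L[ℂ] L2) (f : WeightedL2 K) :
    ⇑(conjVIso K D f) =ᵐ[weightedMeasure K]
      fun ξ => (Real.exp (-(K * ξ)) : ℂ) * D ((VIso K).symm f) ξ :=
  MemLp.coeFn_toLp (VIso_memLp K (D ((VIso K).symm f)))

theorem coeFn_VIso_symm (K : ℝ) (f : WeightedL2 K) :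
    ⇑((VIso K).symm f) =ᵐ[volume] fun ξ => (Real.exp (K * ξ) : ℂ) * f ξ :=
  MemLp.coeFn_toLp (VIso_symm_memLp K f)

/-- The closure of `B^{-1/2} cos(τ p̄) B^{1/2}`, where `s = τ / K`. -/
def conjCos (K s : ℝ) : L2 →L[ℂ] L2 :=
  (1 / 2 : ℂ) • ((Real.exp (-(K * s)) : ℂ) • shiftL2 s + (Real.exp (K * s) : ℂ) • shiftL2 (-s))

theorem coeFn_smul_add_shiftL2 (a b c : ℂ) (s t : ℝ) (f : L2) :
    ⇑((c • (a • shiftL2 s + b • shiftL2 t)) f) =ᵐ[volume]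
      fun ξ => c * (a * f (ξ + s) + b * f (ξ + t)) := by
  change ⇑(c • (a • shiftL2 s f + b • shiftL2 t f)) =ᵐ[volume] _
  filter_upwards [Lp.coeFn_smul c (a • shiftL2 s f + b • shiftL2 t f),
    Lp.coeFn_add (a • shiftL2 s f) (b • shiftL2 t f), Lp.coeFn_smul a (shiftL2 s f),
    Lp.coeFn_smul b (shiftL2 t f), coeFn_shiftL2 s f, coeFn_shiftL2 t f] with ξ h1 h2 h3 h4 h5 h6
  rw [h1, Pi.smul_apply, h2, Pi.add_apply, h3, h4, Pi.smul_apply, Pi.smul_apply, h5, h6]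
  rfl

theorem ae_comp_add_right {p : ℝ → Prop} (h : ∀ᵐ ξ, p ξ) (s : ℝ) : ∀ᵐ ξ, p (ξ + s) :=
  (measurePreserving_add_right volume s).quasiMeasurePreserving.ae h

theorem exp_neg_mul_add_mul_exp (K ξ s : ℝ) :
    (Real.exp (-(K * (ξ + s))) : ℂ) = Real.exp (-(K * ξ)) * Real.exp (-(K * s)) := by
  rw [← Complex.ofReal_mul, ← Real.exp_add]; congr 2; ring

/-- Since $e^{-K(\xi\pm s)}=e^{-K\xi}e^{\mp Ks}$, each translation commutes with the weight up to
the constants in `conjCos`. -/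
theorem shift_average_intertwines (K s : ℝ) (x z : L2)
    (hz : ⇑z =ᵐ[volume] fun ξ => (Real.exp (-(K * ξ)) : ℂ) * x ξ) :
    ⇑(((1 / 2 : ℂ) • (shiftL2 s + shiftL2 (-s)) : L2 →L[ℂ] L2) z) =ᵐ[volume]
      fun ξ => (Real.exp (-(K * ξ)) : ℂ) * conjCos K s x ξ := by
  have h := coeFn_smul_add_shiftL2 1 1 (1 / 2) s (-s) z
  rw [one_smul, one_smul] at h
  filter_upwards [h, coeFn_smul_add_shiftL2 (Real.exp (-(K * s)) : ℂ) (Real.exp (K * s) : ℂ) (1 / 2)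
    s (-s) x, ae_comp_add_right hz s, ae_comp_add_right hz (-s)] with ξ h1 h2 h3 h4
  rw [h1, conjCos, h2, h3, h4, exp_neg_mul_add_mul_exp, exp_neg_mul_add_mul_exp, mul_neg, neg_neg]
  ring

/-- The constants cancel: $e^{-K\xi}\,e^{\mp Ks}\,e^{K(\xi\pm s)}=1$. -/
theorem coeFn_conjVIso_conjCos (K s : ℝ) (f : WeightedL2 K) :
    ⇑(conjVIso K (conjCos K s) f) =ᵐ[weightedMeasure K]
      fun ξ => (1 / 2 : ℂ) * (f (ξ + s) + f (ξ - s)) := by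
  have hf := coeFn_VIso_symm K f
  filter_upwards [coeFn_conjVIso K (conjCos K s) f,
    (weightedMeasure_ac K).ae_le (coeFn_smul_add_shiftL2 (Real.exp (-(K * s)) : ℂ)
      (Real.exp (K * s) : ℂ) (1 / 2) s (-s) ((VIso K).symm f)),
    (weightedMeasure_ac K).ae_le (ae_comp_add_right hf s),
    (weightedMeasure_ac K).ae_le (ae_comp_add_right hf (-s))] with ξ h1 h2 h3 h4
  have e1 := exp_neg_mul_exp_mul (K * (ξ + s)) (f (ξ + s))
  have e2 := exp_neg_mul_exp_mul (K * (ξ + -s)) (f (ξ + -s))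
  rw [exp_neg_mul_add_mul_exp] at e1 e2
  rw [mul_neg K s, neg_neg] at e2
  rw [h1, conjCos, h2, h3, h4, sub_eq_add_neg]
  linear_combination (1 / 2 : ℂ) * e1 + (1 / 2 : ℂ) * e2

/-! ### Convolutions and the exponential weight. -/

theorem continuous_ofReal_exp_mul (K : ℝ) : Continuous fun t : ℝ => (Real.exp (K * t) : ℂ) := by
  fun_prop

theorem indicator_mul_exp_neg (K r ξ t : ℝ) (y : ℂ) :
    (Set.Icc (-r) r).indicator (fun _ => (1 : ℂ)) t * ((Real.exp (-(K * (ξ - t))) : ℂ) * y) =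
      (Real.exp (-(K * ξ)) : ℂ) *
        ((Set.Icc (-r) r).indicator (fun t => (Real.exp (K * t) : ℂ)) t * y) := by
  by_cases ht : t ∈ Set.Icc (-r) r
  · rw [Set.indicator_of_mem ht, Set.indicator_of_mem ht, sub_eq_add_neg,
      exp_neg_mul_add_mul_exp, mul_neg, neg_neg]
    ring
  · simp [Set.indicator_of_notMem ht]

theorem convolution_indicator_exp_neg_mul (K r : ℝ) (x : ℝ → ℂ) (ξ : ℝ) :
    convolution ((Set.Icc (-r) r).indicator fun _ => (1 : ℂ))
      (fun ξ => (Real.exp (-(K * ξ)) : ℂ) * x ξ) (ContinuousLinearMap.mul ℂ ℂ) volume ξ =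
    (Real.exp (-(K * ξ)) : ℂ) * convolution
      ((Set.Icc (-r) r).indicator fun t => (Real.exp (K * t) : ℂ)) x
      (ContinuousLinearMap.mul ℂ ℂ) volume ξ := by
  simp only [convolution_def, ContinuousLinearMap.mul_apply']
  rw [← integral_const_mul]
  exact integral_congr_ae (Eventually.of_forall fun t => indicator_mul_exp_neg K r ξ t _)

/-- A weighted $g$ need not lie in $L^2(\mathbb R)$, but $e^{K\xi}g$ does. The integrand is
$e^{-K\xi}$ times that of the convolution of $e^{K\xi}g$ with the $L^2$ kernel $e^{Kt}$ on $[-r,r]$.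
-/
theorem convolutionExists_indicator (K r : ℝ) (g : WeightedL2 K) :
    ConvolutionExists ((Set.Icc (-r) r).indicator fun _ => (1 : ℂ)) g
      (ContinuousLinearMap.mul ℂ ℂ) volume := by
  intro ξ
  have h := (convolutionExists_of_memLp (memLp_indicator_Icc (continuous_ofReal_exp_mul K) r)
    (VIso_symm_memLp K g) ξ).const_mul (Real.exp (-(K * ξ)) : ℂ)
  refine h.congr (Eventually.of_forall fun t => ?_)
  simp only [ContinuousLinearMap.mul_apply']
  rw [← indicator_mul_exp_neg, exp_neg_mul_exp_mul]

/-- The closure of `B^{-1/2} (sin(τ p̄) / p̄) B^{1/2}`, where `c = K sgn(τ) / 2` and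
`r = |τ| / K`. -/
def conjSinDiv (K : ℝ) (c : ℂ) (r : ℝ) : L2 →L[ℂ] L2 :=
  c • convIcc (fun t => (Real.exp (K * t) : ℂ)) (continuous_ofReal_exp_mul K) r

theorem coeFn_conjSinDiv (K : ℝ) (c : ℂ) (r : ℝ) (f : L2) : ⇑(conjSinDiv K c r f) =ᵐ[volume]
    fun ξ => c * convolution ((Set.Icc (-r) r).indicator fun t => (Real.exp (K * t) : ℂ)) f
      (ContinuousLinearMap.mul ℂ ℂ) volume ξ := by
  filter_upwards [coeFn_convIcc (continuous_ofReal_exp_mul K) r f, Lp.coeFn_smul c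
    (convIcc (fun t => (Real.exp (K * t) : ℂ)) (continuous_ofReal_exp_mul K) r f)] with ξ h1 h2
  exact h2.trans (by rw [Pi.smul_apply, h1, smul_eq_mul])

theorem convolution_intertwines (K : ℝ) (c : ℂ) (r : ℝ) (x z : L2)
    (hz : ⇑z =ᵐ[volume] fun ξ => (Real.exp (-(K * ξ)) : ℂ) * x ξ) :
    ⇑((c • convIcc (fun _ => 1) continuous_const r : L2 →L[ℂ] L2) z) =ᵐ[volume]
      fun ξ => (Real.exp (-(K * ξ)) : ℂ) * conjSinDiv K c r x ξ := by
  filter_upwards [coeFn_conjSinDiv K c r x, coeFn_convIcc (k := fun _ => 1) continuous_const r z,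
    Lp.coeFn_smul c (convIcc (fun _ => 1) continuous_const r z)] with ξ h1 h2 h3
  refine h3.trans ?_
  rw [Pi.smul_apply, h2, h1, convolution_congr _ (ae_eq_refl _) hz,
    convolution_indicator_exp_neg_mul, smul_eq_mul, mul_left_comm]

theorem coeFn_conjVIso_conjSinDiv (K : ℝ) (c : ℂ) (r : ℝ) (g : WeightedL2 K) :
    ⇑(conjVIso K (conjSinDiv K c r) g) =ᵐ[weightedMeasure K]
      fun ξ => c * convolution ((Set.Icc (-r) r).indicator fun _ => (1 : ℂ)) g
        (ContinuousLinearMap.mul ℂ ℂ) volume ξ := by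
  filter_upwards [coeFn_conjVIso K (conjSinDiv K c r) g,
    (weightedMeasure_ac K).ae_le (coeFn_conjSinDiv K c r ((VIso K).symm g))] with ξ h1 h2
  rw [h1, h2, convolution_congr _ (ae_eq_refl _) (coeFn_VIso_symm K g), mul_left_comm,
    ← convolution_indicator_exp_neg_mul]
  simp only [exp_neg_mul_exp_mul]

end

/-! ### The main theorem. -/

theorem theorem3 (K : ℝ) (hK : 0 < K) (τ : ℝ) :
    (Dense ((BConj K (cosOp K τ)).domain : Set L2) ∧
      (BConj K (cosOp K τ)).IsClosable ∧
      ∃ C : WeightedL2 K →L[ℂ] WeightedL2 K,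
        (BConj K (cosOp K τ)).closure.transport (VIso K) = C.toLinearMap.toPMap ⊤ ∧
        ∀ f : WeightedL2 K,
          C f =ᵐ[weightedMeasure K]
            fun ξ => (1 / 2 : ℂ) * (f (ξ + τ / K) + f (ξ - τ / K))) ∧
    (Dense ((BConj K (sinDivOp K τ)).domain : Set L2) ∧
      (BConj K (sinDivOp K τ)).IsClosable ∧
      ∃ S : WeightedL2 K →L[ℂ] WeightedL2 K,
        (BConj K (sinDivOp K τ)).closure.transport (VIso K) = S.toLinearMap.toPMap ⊤ ∧
        ∀ g : WeightedL2 K,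
          ConvolutionExists ((Set.Icc (-(|τ| / K)) (|τ| / K)).indicator fun _ => (1 : ℂ)) g
            (ContinuousLinearMap.mul ℂ ℂ) volume ∧
          S g =ᵐ[weightedMeasure K]
            fun ξ => ((K / 2 * Real.sign τ : ℝ) : ℂ) *
              convolution ((Set.Icc (-(|τ| / K)) (|τ| / K)).indicator fun _ => (1 : ℂ)) g
                (ContinuousLinearMap.mul ℂ ℂ) volume ξ) := by
  obtain ⟨hc1, hc2, hc3⟩ := BConj_closure_eq (shift_average_intertwines K (τ / K))
  obtain ⟨hs1, hs2, hs3⟩ := BConj_closure_eq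
    (convolution_intertwines K ((K / 2 * Real.sign τ : ℝ) : ℂ) (|τ| / K))
  rw [← cosOp_eq] at hc1 hc2 hc3
  rw [← sinDivOp_eq hK] at hs1 hs2 hs3
  refine ⟨⟨hc1, hc2, conjVIso K (conjCos K (τ / K)), ?_, coeFn_conjVIso_conjCos K (τ / K)⟩,
    hs1, hs2, conjVIso K (conjSinDiv K ((K / 2 * Real.sign τ : ℝ) : ℂ) (|τ| / K)), ?_, fun g =>
      ⟨convolutionExists_indicator K _ g, coeFn_conjVIso_conjSinDiv K _ _ g⟩⟩
  · rw [hc3, transport_VIso_toPMap]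
  · rw [hs3, transport_VIso_toPMap]
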